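/- **Setting.** Points of the plane are $(t,x)$; for $\mathbf n=(n_1,n_2)\in\mathbb N^2$ put $\mathbf n!=n_1!\,n_2!$, $\partial^{\mathbf n}=\partial_t^{n_1}\partial_x^{n_2}$, $\|\mathbf n\|=2n_1+n_2$, and let $e_{\mathbf n}$ be the indicator of $\{\mathbf n\}$. Let $\mathcal N$ be the set of pairs $(\Xi,m e_{(0,0)})$, $m\in\mathbb N$, and $(0,k e_{(0,0)}+l e_{(0,1)})$, $k\in\mathbb N$, $l\in\{0,1,2\}$. Multi-indices are the finitely supported functions $\beta:\mathcal N\sqcup(\mathbb N^2\setminus\{0\})\to\mathbb N$, identified with monomials $z^\beta$ in variables $z_{(\mathfrak l,k)}$, $z_{\mathbf n}$. For $0<\delta<1$, $\alpha_\Xi=-2+\delta/2$, $\alpha_0=0$ set $$((\beta))=\sum_m\beta(\Xi,me_{(0,0)}),\qquad [\beta]=\sum_{(\mathfrak l,k)}\Big(1-\sum_{\mathbf n}k(\mathbf n)\Big)\beta(\mathfrak l,k)+\sum_{\mathbf n}\beta(\mathbf n),$$ $$|\beta|=\sum_{(\mathfrak l,k)}\Big(\alpha_{\mathfrak l}+\sum_{\mathbf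 n}(2-\|\mathbf n\|)k(\mathbf n)\Big)\beta(\mathfrak l,k)+\sum_{\mathbf n}(\|\mathbf n\|-2)\beta(\mathbf n),$$ $T=\{\beta:[\beta]=1,\ ((\beta))>0\}$ and $T_-=\{\beta\in T:|\beta|<0\}$. Let $\mathfrak M_{\Gamma,\Xi}$ be the set of $\beta$ with $[\beta]=1$ and $((\beta))\ge2$ in which only the variables $z_{(\Xi,ke_{(0,0)})}$ and $z_{(0,ke_{(0,0)}+2e_{(0,1)})}$ occur, $\mathfrak M^{\mathrm{even}}_{\Gamma,\Xi}$ its subset where $((\beta))$ is even, and let a superscript $-$ denote the restriction to $|\beta|<0$. **Kernel and noise.** Let $K$ be a compactly supported function on $\mathbb R^2$ with $K(t,-x)=K(t,x)$ and $\int K(z)z^{\mathbf n}dz=0$ for $\|\mathbf n\|\le1$, such that the heat kernel on $\mathbb R$ is the sum of $K$ and a smooth function away from the origin. Let $\varrho$ be smooth, compactly supported, of integral $1$, even in $x$, and zero for $t\le0$; put $\varrho_\varepsilon(t,x)=\varepsilon^{-3}\varrho(\varepsilon^{-2}t,\varepsilon^{-1}x)$ and $\xi_\varepsilon=\varrho_\varepsilon*\xi$.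 A random distribution $\xi$ on $\mathbb R^2$ is *admissible* if every $\xi(\varphi)$ is centred with moments of all orders; its law is invariant under translations; for $n\ge3$ the joint cumulants $\mathbb K[\xi(\varphi_1),\dots,\xi(\varphi_n)]$ are given by integrating $\prod_i\varphi_i(z_i)$ against a locally integrable function on $(\mathbb R^2)^n$; and $\mathbb E[\xi(f)\xi(g)]=\mathcal C\big(\int f(z-\cdot)g(z)\,dz\big)$ for a distribution $\mathcal C$ that is a smooth function outside $0$ and satisfies, for some $0<\kappa<1$ and all $\mathbf k=(k_1,k_2)$, $$\sup_{(t,x)\neq0}|\partial_t^{k_1}\partial_x^{k_2}\mathcal C(t,x)|\big(|t|^{2+k_1+k_2/2-\kappa}+|x|^{4+2k_1+k_2-\kappa}\big)<\infty .$$ Spatially $L$-periodic extensions of noises on $\mathbb R\times(\mathbb R/L\mathbb Z)$ are included: then the singular support of $\mathcal C$ lies in $\{0\}\times L\mathbb Z$, and the bound is required for $|x|\le L/2$, outside $\{0\}\times L\mathbb Z$. **Model.** The canonical model $(\Pi^\varepsilon,\Pi^{-,\varepsilon})$ is defined recursively by $\Pi^\varepsilon_\beta(y)=y_1^{n_1}y_2^{n_2}$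 if $z^\beta=z_{\mathbf n}$, $\Pi^\varepsilon_\beta=K*\Pi^{-,\varepsilon}_\beta$ if $\beta\in T$, $\Pi^\varepsilon_\beta=0$ otherwise, and $$\Pi^{-,\varepsilon}_\beta=\sum_{(\mathfrak l,k)\in\mathcal N}\ \sum_{z^\beta=z_{(\mathfrak l,k)}\prod_{\mathbf n}\prod_{i=1}^{k(\mathbf n)}z^{\beta_{\mathbf n,i}}}\ \prod_{\mathbf n}\prod_{i=1}^{k(\mathbf n)}\Big(\tfrac1{\mathbf n!}\partial^{\mathbf n}\Pi^\varepsilon_{\beta_{\mathbf n,i}}\Big)\,\xi_{\mathfrak l},\qquad \xi_\Xi=\xi_\varepsilon,\ \xi_0=1,$$ the inner sum being over ordered families. For $c=\sum_{\beta'\in T_-}c_{\beta'}z^{\beta'}$ the renormalised model is given by $\Pi^{-,\varepsilon,c}_\beta=\Pi^{-,\varepsilon}_\beta+(\Gamma^*c)(\beta)$, with $\Pi^{\varepsilon,c}$ obtained from $\Pi^{-,\varepsilon,c}$ as $\Pi^\varepsilon$ is from $\Pi^{-,\varepsilon}$, where $$(\Gamma^*c)(\beta)=\sum_{l\ge0}\frac1{l!}\sum_{\mathbf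 n_1,\dots,\mathbf n_l}\ \sum_{\beta_1,\dots,\beta_l}\Big(\prod_{i=1}^l\tfrac1{\mathbf n_i!}\partial^{\mathbf n_i}\Pi^{\varepsilon,c}_{\beta_i}\Big)\cdot\big(\text{coefficient of }z^\beta\text{ in }z^{\beta_1}\cdots z^{\beta_l}D^{(\mathbf n_1)}\cdots D^{(\mathbf n_l)}c\big),$$ pairs with $z^{\beta_i}=z_{\mathbf n_i}$ being left out, and $D^{(\mathbf n)}=\sum_{(\mathfrak l,k)}(k(\mathbf n)+1)z_{(\mathfrak l,k+e_{\mathbf n})}\partial_{z_{(\mathfrak l,k)}}+\partial_{z_{\mathbf n}}$ (terms with $(\mathfrak l,k+e_{\mathbf n})\notin\mathcal N$, and $\partial_{z_{\mathbf n}}$ for $\mathbf n=0$, being omitted). The *BPHZ constants* $c^*_\varepsilon$ are the $c$ for which $\mathbb E[\Pi^{-,\varepsilon,c}_\beta(y)]=0$ (with $\Pi^{-,\varepsilon,c}_\beta(y)$ integrable) for all $\beta\in T_-$ and $y\in\mathbb R^2$. An admissible noise is *spatially symmetric* if, for all $\varepsilon>0$ and all $\beta\in T_-$ containing a factor $z_{(0,ke_{(0,0)}+e_{(0,1)})}$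 for some $k$ or a factor $z_{\mathbf n}$ with $\mathbf n=(0,1)$, the processes $\Pi^{-,\varepsilon}_\beta(t,-x)$ and $-\Pi^{-,\varepsilon}_\beta(t,x)$, indexed by $(t,x)$, have the same law. **Proposition.** Let $0<\delta<1$, $\varepsilon>0$, and let $\xi$ be a spatially symmetric admissible noise. Then $c^*_\varepsilon(\beta)=0$ for every $\beta\in T_-\setminus\mathfrak M^-_{\Gamma,\Xi}$. If $\xi$ is moreover Gaussian, then $c^*_\varepsilon(\beta)=0$ for every $\beta\in T_-\setminus(\mathfrak M^{\mathrm{even}}_{\Gamma,\Xi})^-$. -/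

import Mathlib

open MeasureTheory ProbabilityTheory TopologicalSpace MvPolynomial
open scoped Distributions

noncomputable section

namespace MultiIndexKPZ

/-! ### Multi-indices

Points of the plane are `(t, x) : ℝ × ℝ`, and `n = (n₁, n₂) : ℕ × ℕ` refers to time and space in
this order. -/

/-- The set `𝒩 = 𝒩_Ξ ⊔ 𝒩_0` of non-linearities: `noise m` is `(Ξ, m e_(0,0))` and `drift k l` is
`(0, k e_(0,0) + l e_(0,1))` with `l ∈ {0, 1, 2}`. -/
inductive Node : Type
  | noise (m : ℕ) : Node
  | drift (k : ℕ) (l : Fin 3) : Node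
  deriving DecidableEq

/-- For a node `(𝔩, k)`, the value `k(n)`. -/
def Node.mult : Node → ℕ × ℕ → ℕ
  | .noise m, n => if n = (0, 0) then m else 0
  | .drift k l, n => if n = (0, 0) then k else if n = (0, 1) then l else 0

/-- The length `ℓ(k) = ∑ₙ k(n)`; only `n = (0,0)` and `n = (0,1)` contribute. -/
def Node.length (v : Node) : ℕ := v.mult (0, 0) + v.mult (0, 1)

/-- The index set `ℛ = 𝒩 ⊔ (ℕ² ∖ {0})` of the variables `z_(𝔩,k)` and `z_n`. -/
abbrev Var : Type := Node ⊕ {n : ℕ × ℕ // n ≠ 0}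

/-- Multi-indices: finitely supported functions `ℛ → ℕ`. -/
abbrev MI : Type := Var →₀ ℕ

/-- The variable `z_(0,1)`. -/
def polyX : Var := Sum.inr ⟨(0, 1), by simp⟩

/-- Parabolic degree `‖n‖ = 2 n₁ + n₂`. -/
def pdeg (n : ℕ × ℕ) : ℕ := 2 * n.1 + n.2

/-- Contribution of a variable to the noise factor. -/
def varNoise : Var → ℕ
  | .inl (.noise _) => 1
  | .inl (.drift _ _) => 0
  | .inr _ => 0

/-- The noise factor `((β))`. -/
def noiseCount (β : MI) : ℕ := β.sum fun v b => b * varNoise v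

/-- Contribution of a variable to the fertility factor. -/
def varFert : Var → ℤ
  | .inl v => 1 - (v.length : ℤ)
  | .inr _ => 1

/-- The fertility factor `[β]`. -/
def fert (β : MI) : ℤ := β.sum fun v b => (b : ℤ) * varFert v

/-- The regularities `α_Ξ = -2 + δ/2` and `α_0 = 0`. -/
def Node.reg (δ : ℝ) : Node → ℝ
  | .noise _ => -2 + δ / 2
  | .drift _ _ => 0

/-- Contribution of a variable to the homogeneity: `α_𝔩 + ∑ₙ (2 - ‖n‖) k(n)` for `z_(𝔩,k)`, and
`‖n‖ - 2` for `z_n`. -/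
def varHom (δ : ℝ) : Var → ℝ
  | .inl v => v.reg δ + (2 * (v.mult (0, 0) : ℝ) + (v.mult (0, 1) : ℝ))
  | .inr n => (pdeg n.1 : ℝ) - 2

/-- The homogeneity `|β|`. -/
def hom (δ : ℝ) (β : MI) : ℝ := β.sum fun v b => (b : ℝ) * varHom δ v

/-- `T = {β : [β] = 1, ((β)) > 0}`. -/
def T : Set MI := {β | fert β = 1 ∧ 0 < noiseCount β}

/-- `T₋`, the elements of `T` of negative homogeneity. -/
def Tneg (δ : ℝ) : Set MI := {β | β ∈ T ∧ hom δ β < 0}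

/-- The reduced multi-indices: only the variables `z_(Ξ,k)` and `z_(0, k e_(0,0) + 2 e_(0,1))`
occur, `[β] = 1` and `((β)) ≥ 2`. -/
def reduced : Set MI :=
  {β | (∀ v ∈ β.support, (∃ k, v = Sum.inl (.noise k)) ∨ ∃ k, v = Sum.inl (.drift k 2)) ∧
    fert β = 1 ∧ 2 ≤ noiseCount β}

/-- The even-reduced multi-indices. -/
def reducedEven : Set MI := {β | β ∈ reduced ∧ Even (noiseCount β)}

/-- The reduced multi-indices of negative homogeneity. -/
def reducedNeg (δ : ℝ) : Set MI := {β | β ∈ reduced ∧ hom δ β < 0}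

/-- The even-reduced multi-indices of negative homogeneity. -/
def reducedEvenNeg (δ : ℝ) : Set MI := {β | β ∈ reducedEven ∧ hom δ β < 0}

/-- `β` has a factor `z_(0, k e_(0,0) + e_(0,1))` for some `k`, or a factor `z_(0,1)`. -/
def HasOddFactor (β : MI) : Prop :=
  (∃ k, β (Sum.inl (.drift k 1)) ≠ 0) ∨ β polyX ≠ 0

/-! ### The model as a functional of a smooth driving function -/

/-- `∂ⁿ f = ∂_t^{n₁} ∂_x^{n₂} f`. -/
def pd (n : ℕ × ℕ) (f : ℝ × ℝ → ℝ) (z : ℝ × ℝ) : ℝ :=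
  iteratedDeriv n.1 (fun s => iteratedDeriv n.2 (fun y => f (s, y)) z.2) z.1

/-- Convolution on the plane, `(K * f)(z) = ∫ K(w) f(z - w) dw`. -/
def conv (K f : ℝ × ℝ → ℝ) : ℝ × ℝ → ℝ :=
  convolution K f (ContinuousLinearMap.mul ℝ ℝ) volume

/-- The Taylor coefficient function `(1 / n!) ∂ⁿ f`. -/
def tay (n : ℕ × ℕ) (f : ℝ × ℝ → ℝ) (z : ℝ × ℝ) : ℝ :=
  ((n.1.factorial : ℝ) * (n.2.factorial : ℝ))⁻¹ * pd n f z

/-- The function multiplying a node: `ξ_Ξ = η`, `ξ_0 = 1`. -/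
def Node.source (η : ℝ × ℝ → ℝ) : Node → ℝ × ℝ → ℝ
  | .noise _ => η
  | .drift _ _ => fun _ => 1

/-- The factors to be attached to a node `(𝔩, k)`: `k(n)` many for each `n`. -/
abbrev Node.Slot (v : Node) : Type := Fin (v.mult (0, 0)) ⊕ Fin (v.mult (0, 1))

/-- The derivative carried by a slot. -/
def Node.slotDeriv (v : Node) : v.Slot → ℕ × ℕ :=
  Sum.elim (fun _ => (0, 0)) (fun _ => (0, 1))

/-- The right-hand side of the recursion for `Π⁻_β`, for given functions `Φ_γ`:
`∑_(𝔩,k) ∑_{z^β = z_(𝔩,k) ∏ z^{b i}} ∏ᵢ (1/nᵢ! ∂^{nᵢ} Φ_{b i}) ξ_𝔩`, the product being over the slots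
of `(𝔩,k)` and the inner sum over all families `b` with this property. -/
def canonRHS (η : ℝ × ℝ → ℝ) (Φ : MI → ℝ × ℝ → ℝ) (β : MI) (z : ℝ × ℝ) : ℝ :=
  ∑ w ∈ β.support,
    match w with
    | .inl v =>
        ∑ b ∈ Finset.piAntidiag (Finset.univ : Finset v.Slot) (β - Finsupp.single (.inl v) 1),
          (∏ i, tay (v.slotDeriv i) (Φ (b i)) z) * v.source η z
    | .inr _ => 0

open Classical in
/-- From `Π⁻` to `Π`: `Π_β(y) = y₁^{n₁} y₂^{n₂}` if `z^β = z_n`, `Π_β = K * Π⁻_β` if `β ∈ T`, and there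
are no other components. -/
def integrate (K : ℝ × ℝ → ℝ) (β : MI) (g : ℝ × ℝ → ℝ) : ℝ × ℝ → ℝ :=
  if h : ∃ n, β = Finsupp.single (Sum.inr n) 1 then
    fun z => z.1 ^ (h.choose.1).1 * z.2 ^ (h.choose.1).2
  else if β ∈ T then conv K g
  else fun _ => 0

open Classical in
/-- The canonical `Π_β` driven by `η`. Only components `γ < β` enter the recursion (the remaining
`β - (𝔩,k)` is split among the slots), so cutting off the others changes nothing. -/
def canon (K η : ℝ × ℝ → ℝ) (β : MI) : ℝ × ℝ → ℝ :=
  integrate K β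
    (canonRHS η (fun γ => if _h : γ < β then canon K η γ else fun _ => 0) β)
termination_by β
decreasing_by exact _h

/-- The canonical `Π⁻_β` driven by `η`. -/
def canonMinus (K η : ℝ × ℝ → ℝ) (β : MI) : ℝ × ℝ → ℝ := canonRHS η (canon K η) β

/-- Value of `D⁽ⁿ⁾` on a variable: `(k(n)+1) z_(𝔩, k + e_n)` (zero if `(𝔩, k + e_n) ∉ 𝒩`) and
`D⁽ⁿ⁾ z_m = 1` if `m = n`, else zero. -/
def raise (n : ℕ × ℕ) : Var → MvPolynomial Var ℝ
  | .inl (.noise m) =>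
      if n = (0, 0) then C ((m : ℝ) + 1) * X (Sum.inl (.noise (m + 1))) else 0
  | .inl (.drift k l) =>
      if n = (0, 0) then C ((k : ℝ) + 1) * X (Sum.inl (.drift (k + 1) l))
      else if n = (0, 1) then
        if h : (l : ℕ) + 1 < 3 then
          C (((l : ℕ) : ℝ) + 1) * X (Sum.inl (.drift k ⟨(l : ℕ) + 1, h⟩))
        else 0
      else 0
  | .inr m => if m.1 = n then 1 else 0

/-- The derivation `D⁽ⁿ⁾` on polynomials in the (dual) variables. -/
def D (n : ℕ × ℕ) : Derivation ℝ (MvPolynomial Var ℝ) (MvPolynomial Var ℝ) :=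
  mkDerivation ℝ (raise n)

/-- `D⁽ⁿ¹⁾ ⋯ D⁽ⁿˡ⁾ c`. -/
def iterD {l : ℕ} (n : Fin l → ℕ × ℕ) (c : MvPolynomial Var ℝ) : MvPolynomial Var ℝ :=
  (List.ofFn n).foldr (fun m q => D m q) c

open Classical in
/-- `(1 / n!) ∂ⁿ Φ_b`, where for `n ≠ 0` the pair `z^b = z_n` is left out. (That component of the jet
is the variable `z_n` of `c` itself, and is thus already accounted for by the term without
`D⁽ⁿ⁾`.) -/
def jet (Φ : MI → ℝ × ℝ → ℝ) (n : ℕ × ℕ) (b : MI) (z : ℝ × ℝ) : ℝ :=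
  if ∃ h : n ≠ 0, b = Finsupp.single (Sum.inr ⟨n, h⟩) 1 then 0 else tay n (Φ b) z

/-- `(Γ*_Φ c)(β) = ∑ₗ 1/l! ∑ ∏ᵢ (1/nᵢ! ∂^{nᵢ} Φ_{b i}) ⟨z^{b 1} ⋯ z^{b l} D⁽ⁿ¹⁾ ⋯ D⁽ⁿˡ⁾ c, z^β⟩`.
The pairing vanishes unless all `b i ≤ β` and `l` is at most the number of factors of `z^β` (as
`Φ_0 = 0`), and, for `c` supported in `T₋`, unless all `nᵢ ∈ {(0,0), (0,1)}`; so the sum is over all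
`l`, `n`, `b`. -/
def gammaStar (Φ : MI → ℝ × ℝ → ℝ) (c : MvPolynomial Var ℝ) (β : MI) (z : ℝ × ℝ) : ℝ :=
  ∑ l ∈ Finset.range (β.degree + 1), (l.factorial : ℝ)⁻¹ *
    ∑ n ∈ Fintype.piFinset (fun _ : Fin l => ({(0, 0), (0, 1)} : Finset (ℕ × ℕ))),
      ∑ b ∈ Fintype.piFinset (fun _ : Fin l => Finset.Icc 0 β),
        (∏ i, jet Φ (n i) (b i) z) * coeff β ((∏ i, monomial (b i) 1) * iterD n c)

open Classical in
/-- The renormalised `Π^c_β` driven by `η`, i.e. `K * Π^{-,c}_β`. Again only components `γ < β` enter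
the recursion when `c` is supported in `T₋` (each term of `D⁽ⁿ¹⁾ ⋯ D⁽ⁿˡ⁾ c` contains a noise
variable), so the cut-off changes nothing. -/
def renorm (K η : ℝ × ℝ → ℝ) (c : MvPolynomial Var ℝ) (β : MI) : ℝ × ℝ → ℝ :=
  integrate K β (fun z => canonMinus K η β z +
    gammaStar (fun γ => if _h : γ < β then renorm K η c γ else fun _ => 0) c β z)
termination_by β
decreasing_by exact _h

/-- The renormalised `Π^{-,c}_β = Π⁻_β + (Γ*_{Π^c} c)(β)` driven by `η`. -/
def renormMinus (K η : ℝ × ℝ → ℝ) (c : MvPolynomial Var ℝ) (β : MI) (z : ℝ × ℝ) : ℝ :=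
  canonMinus K η β z + gammaStar (renorm K η c) c β z

/-! ### Kernel and mollifier -/

/-- The heat kernel on the real line. -/
def heatKernel (z : ℝ × ℝ) : ℝ :=
  if 0 < z.1 then Real.exp (-(z.2 ^ 2) / (4 * z.1)) / Real.sqrt (4 * Real.pi * z.1) else 0

/-- `K` is a truncation of the heat kernel: `P = K + R` with `R` smooth, `K` is compactly supported,
annihilates polynomials of parabolic degree at most one and is even in space. -/
structure IsTruncatedHeatKernel (K : ℝ × ℝ → ℝ) : Prop where
  decomposition : ∃ R : ℝ × ℝ → ℝ, ContDiff ℝ (⊤ : ℕ∞) R ∧ ∀ z, z ≠ 0 → heatKernel z = K z + R z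
  compact : HasCompactSupport K
  annihilates : ∀ n : ℕ × ℕ, pdeg n ≤ 1 → ∫ z : ℝ × ℝ, K z * (z.1 ^ n.1 * z.2 ^ n.2) = 0
  even : ∀ t x, K (t, -x) = K (t, x)

/-- Test functions on the plane. -/
abbrev TestFn : Type := 𝓓((⊤ : Opens (ℝ × ℝ)), ℝ)

/-- Distributions on the plane. -/
abbrev Distr : Type := 𝓓'((⊤ : Opens (ℝ × ℝ)), ℝ)

/-- The conditions on the (smooth, compactly supported) mollifier. -/
structure IsMollifier (ρ : TestFn) : Prop where
  integral_eq_one : ∫ z, ρ z = 1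
  even : ∀ t x, ρ (t, -x) = ρ (t, x)
  causal : ∀ t x, t ≤ 0 → ρ (t, x) = 0

/-- `ρ_ε(t,x) = ε⁻³ ρ(ε⁻² t, ε⁻¹ x)`. -/
def rescale (ρ : ℝ × ℝ → ℝ) (ε : ℝ) (z : ℝ × ℝ) : ℝ :=
  (ε ^ 3)⁻¹ * ρ ((ε ^ 2)⁻¹ * z.1, ε⁻¹ * z.2)

/-- The homeomorphism `w ↦ (ε⁻² (y₁ - w₁), ε⁻¹ (y₂ - w₂))`. -/
def rescaleHomeo (ε : ℝ) (hε : 0 < ε) (y : ℝ × ℝ) : (ℝ × ℝ) ≃ₜ (ℝ × ℝ) :=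
  (Homeomorph.subLeft y).trans
    ((Homeomorph.mulLeft₀ ((ε ^ 2)⁻¹) (by positivity)).prodCongr
      (Homeomorph.mulLeft₀ ε⁻¹ (by positivity)))

/-- The test function `w ↦ ρ_ε(y - w)`. -/
def mollAt (ρ : TestFn) (ε : ℝ) (hε : 0 < ε) (y : ℝ × ℝ) : TestFn where
  toFun := fun w => rescale ρ ε (y - w)
  contDiff' := by
    have h : ContDiff ℝ (⊤ : ℕ∞) (ρ : ℝ × ℝ → ℝ) := ρ.contDiff
    unfold rescale
    exact contDiff_const.mul (h.comp (by fun_prop))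
  hasCompactSupport' := by
    have h := ρ.hasCompactSupport.comp_homeomorph (rescaleHomeo ε hε y)
    exact HasCompactSupport.mul_left (f := fun _ => (ε ^ 3)⁻¹) h
  tsupport_subset' := by simp

/-- The translate `w ↦ φ(w - h)`. -/
def translate (h : ℝ × ℝ) (φ : TestFn) : TestFn where
  toFun := fun w => φ (w - h)
  contDiff' := by
    have hφ : ContDiff ℝ (⊤ : ℕ∞) (φ : ℝ × ℝ → ℝ) := φ.contDiff
    exact hφ.comp (by fun_prop)
  hasCompactSupport' := φ.hasCompactSupport.comp_homeomorph (Homeomorph.subRight h)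
  tsupport_subset' := by simp

/-- The reflection `w ↦ φ(-w)`. -/
def reflect (φ : TestFn) : TestFn where
  toFun := fun w => φ (-w)
  contDiff' := by
    have hφ : ContDiff ℝ (⊤ : ℕ∞) (φ : ℝ × ℝ → ℝ) := φ.contDiff
    exact hφ.comp (by fun_prop)
  hasCompactSupport' := φ.hasCompactSupport.comp_homeomorph (Homeomorph.neg (ℝ × ℝ))
  tsupport_subset' := by simp

/-- The test function `w ↦ ∫ f(z - w) g(z) dz`, i.e. the convolution of `g` with the reflection
of `f`. -/
def correlate (f g : TestFn) : TestFn where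
  toFun := convolution g (reflect f) (ContinuousLinearMap.mul ℝ ℝ) volume
  contDiff' := (reflect f).hasCompactSupport.contDiff_convolution_right _
    g.continuous.locallyIntegrable (reflect f).contDiff
  hasCompactSupport' := g.hasCompactSupport.convolution _ (reflect f).hasCompactSupport
  tsupport_subset' := by simp

theorem correlate_apply (f g : TestFn) (w : ℝ × ℝ) :
    correlate f g w = ∫ z, f (z - w) * g z := by
  change ∫ z, g z * f (-(w - z)) = _
  simp [mul_comm]

/-! ### Noises -/

variable {Ω : Type*} [MeasurableSpace Ω]

/-- The mollified noise `ξ_ε = ρ_ε * ξ`. -/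
def mollNoise (ρ : TestFn) (ξ : Ω → Distr) (ε : ℝ) (hε : 0 < ε) (ω : Ω) (y : ℝ × ℝ) : ℝ :=
  ξ ω (mollAt ρ ε hε y)

/-- The joint cumulant `𝕂[X₁, …, Xₙ]`, through its expression by joint moments. -/
def jointCumulant (P : Measure Ω) {n : ℕ} (X : Fin n → Ω → ℝ) : ℝ :=
  ∑ π : Finpartition (Finset.univ : Finset (Fin n)),
    (-1 : ℝ) ^ (π.parts.card - 1) * ((π.parts.card - 1).factorial : ℝ) *
      ∏ B ∈ π.parts, ∫ ω, ∏ i ∈ B, X i ω ∂P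

/-- The points `(0, m L)`, `m ∈ ℤ`; only the origin if `L = 0`. -/
def lattice (L : ℝ) : Set (ℝ × ℝ) := {z | ∃ m : ℤ, z = (0, m * L)}

/-- The condition on the covariance of the noise. -/
def HasAdmissibleCovariance (L : ℝ) (ξ : Ω → Distr) (P : Measure Ω) : Prop :=
  ∃ 𝒞 : Distr, (∀ f g : TestFn, ∫ ω, ξ ω f * ξ ω g ∂P = 𝒞 (correlate f g)) ∧
    ∃ F : ℝ × ℝ → ℝ, ContDiffOn ℝ (⊤ : ℕ∞) F (lattice L)ᶜ ∧
      (∀ φ : TestFn, Disjoint (tsupport φ) (lattice L) → 𝒞 φ = ∫ z, F z * φ z) ∧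
      ∃ κ : ℝ, 0 < κ ∧ κ < 1 ∧ ∀ k : ℕ × ℕ, ∃ M : ℝ, ∀ z ∉ lattice L,
        (L = 0 ∨ |z.2| ≤ L / 2) →
          |pd k F z| * (|z.1| ^ (2 + k.1 + (k.2 : ℝ) / 2 - κ) +
            |z.2| ^ (4 + 2 * k.1 + (k.2 : ℝ) - κ)) ≤ M

/-- Admissible noises: for `L = 0` over the plane, and for `L > 0` over `ℝ × (ℝ / L ℤ)`, given by
their `L`-periodic extension. The covariance formula and the local integrability of the higher
cumulants contain the existence of the distributions `Γⁿ`, `n ≥ 2`. -/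
structure IsAdmissible (L : ℝ) (ξ : Ω → Distr) (P : Measure Ω) : Prop where
  measurable : ∀ φ : TestFn, Measurable fun ω => ξ ω φ
  periodic : ∀ ω, ∀ φ : TestFn, ξ ω (translate (0, L) φ) = ξ ω φ
  moments : ∀ φ : TestFn, ∀ p : ℕ, MemLp (fun ω => ξ ω φ) p P
  centered : ∀ φ : TestFn, ∫ ω, ξ ω φ ∂P = 0
  stationary : ∀ h : ℝ × ℝ,
    IdentDistrib (fun ω (φ : TestFn) => ξ ω (translate h φ)) (fun ω (φ : TestFn) => ξ ω φ) P P
  cumulants : ∀ n : ℕ, 3 ≤ n → ∃ G : (Fin n → ℝ × ℝ) → ℝ, LocallyIntegrable G volume ∧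
    ∀ φ : Fin n → TestFn,
      jointCumulant P (fun i ω => ξ ω (φ i)) = ∫ z, G z * ∏ i, φ i (z i)
  covariance : HasAdmissibleCovariance L ξ P

/-- Spatially symmetric noises: admissible, and for each `β ∈ T₋` with an odd factor the processes
`Π⁻_β(t,-x)` and `-Π⁻_β(t,x)`, indexed by `(t,x)`, have the same law, for each `ε > 0`. -/
structure IsSpatiallySymmetric (δ : ℝ) (K : ℝ × ℝ → ℝ) (ρ : TestFn) (L : ℝ) (ξ : Ω → Distr)
    (P : Measure Ω) : Prop where
  admissible : IsAdmissible L ξ P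
  symmetric : ∀ (ε : ℝ) (hε : 0 < ε), ∀ β ∈ Tneg δ, HasOddFactor β →
    IdentDistrib
      (fun ω (z : ℝ × ℝ) => canonMinus K (mollNoise ρ ξ ε hε ω) β (z.1, -z.2))
      (fun ω (z : ℝ × ℝ) => -canonMinus K (mollNoise ρ ξ ε hε ω) β z) P P

/-- Gaussian noises: `(ξ(φ))_φ` is a Gaussian process. -/
def IsGaussianNoise (ξ : Ω → Distr) (P : Measure Ω) : Prop :=
  IsGaussianProcess (fun (φ : TestFn) ω => ξ ω φ) P

/-- `c = ∑_{β' ∈ T₋} c_{β'} z^{β'}` are BPHZ renormalisation constants: `𝔼[Π^{-,ε,c}_β(y)] = 0` for all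
`β ∈ T₋` and all `y`. -/
structure IsBPHZ (δ : ℝ) (K : ℝ × ℝ → ℝ) (ρ : TestFn) (ξ : Ω → Distr) (P : Measure Ω)
    (ε : ℝ) (hε : 0 < ε) (c : MvPolynomial Var ℝ) : Prop where
  support_subset : ∀ β ∈ c.support, β ∈ Tneg δ
  integrable : ∀ β ∈ Tneg δ, ∀ y,
    Integrable (fun ω => renormMinus K (mollNoise ρ ξ ε hε ω) c β y) P
  expectation_eq_zero : ∀ β ∈ Tneg δ, ∀ y,
    ∫ ω, renormMinus K (mollNoise ρ ξ ε hε ω) c β y ∂P = 0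

end MultiIndexKPZ

end

open MultiIndexKPZ

/-!
The BPHZ constants inherit every sign symmetry of the law of the mollified noise. For signs `a` and
`b` let `(S η)(t, x) = a η(t, b x)`. Since `K` is even in space, the canonical model satisfies
`Π⁻_β[S η](t, x) = σ(β) Π⁻_β[η](t, b x)`, where `σ(β) = ±1` is multiplicative in `z^β`: a noise
variable contributes `a`, the variable `z_(0, k e_(0,0) + l e_(0,1))` contributes `b ^ l` and `z_n`
contributes `b ^ n₂` (`canonMinus_covariant`). The renormalised model has the same covariance as
soon as `c` only charges multi-indices of sign `1`.

The sum `(Γ* c)(β)` is `c_β` plus terms which involve, by the count of a weight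
(`weight_of_coeff_ne_zero`), only constants `c_β'` and components `Π_γ` with `β'` and `γ` of strictly
smaller weight than `β`. If `σ(β) = -1` and, by induction on the weight, all these `c_β'` vanish
unless `σ(β') = 1`, then the functional `η ↦ Π^{-,c}_β[η](0) - c_β` is odd under `S`
(`renormMinus_covariant`). If the law of `ξ_ε` is invariant under `S`, its expectation is zero, and
it is `-c_β` by the choice of `c`; hence `c_β = 0` (`coeff_eq_zero_of_sign_eq_neg_one`). Applying the
invariance of the law of the *process* `ξ_ε` to this functional needs that it is measurable on the
space of smooth paths, which is what `IsSmoothField` propagates through the recursion.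

The reflection `(a, b) = (1, -1)` is a symmetry of the law of `ξ_ε` itself: the multi-index
`z_(Ξ, e_(0,0)) z_(0,1)` belongs to `T₋`, has an odd factor, and its canonical component is
`x ξ_ε(t, x)`, from which `ξ_ε` is recovered by dividing by `x` and by continuity
(`identDistrib_reflect`). For a centred Gaussian noise, `(a, b) = (-1, 1)` is a symmetry too.

It remains to count: on `T₋` the homogeneity is `|β| = q(β) + (δ/2) ((β)) - 2` with a nonnegative
integer `q`, so that `q(β) ≤ 1`, and `σ(β) = (-1) ^ q(β)` for the reflection. If `q(β) = 0` then `β` is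
reduced unless it is `z_(Ξ,0)`, for which `Π^{-,c}_β = ξ_ε + c_β` and the claim is `𝔼 ξ_ε = 0`
(`eq_single_or_sign_of_notMem_reducedNeg`). For the change of sign, `σ(β) = (-1) ^ ((β))`.
-/

noncomputable section

namespace MultiIndexKPZ

/-! ### Smoothness of the mollified noise -/

section TestFunctions

open scoped LineDeriv

/-- A directional derivative commutes with iterated derivatives. -/
theorem iteratedFDeriv_fderiv_apply {E F : Type*} [NormedAddCommGroup E] [NormedSpace ℝ E]
    [NormedAddCommGroup F] [NormedSpace ℝ F] {f : E → F} (hf : ContDiff ℝ (⊤ : ℕ∞) f) (e : E) (i : ℕ)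
    (x : E) : iteratedFDeriv ℝ i (fun y => fderiv ℝ f y e) x =
      fderiv ℝ (iteratedFDeriv ℝ i f) x e := by
  induction i generalizing x with
  | zero =>
    have h := LinearIsometryEquiv.comp_fderiv
      (continuousMultilinearCurryFin0 ℝ E F).symm (f := f) (x := x)
    ext m
    rw [iteratedFDeriv_zero_eq_comp, iteratedFDeriv_zero_eq_comp, h]
    rfl
  | succ i ih =>
    have hg : ContDiff ℝ (⊤ : ℕ∞) (iteratedFDeriv ℝ i f) :=
      hf.iteratedFDeriv_right (m := ((⊤ : ℕ∞) : WithTop ℕ∞)) (by exact_mod_cast le_top)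
    have hdg : Differentiable ℝ (fderiv ℝ (iteratedFDeriv ℝ i f)) :=
      (hg.fderiv_right (m := ((⊤ : ℕ∞) : WithTop ℕ∞)) (by simp)).differentiable (by simp)
    have hs : IsSymmSndFDerivAt ℝ (iteratedFDeriv ℝ i f) x :=
      hg.contDiffAt.isSymmSndFDerivAt (by simpa using WithTop.coe_le_coe.2 (le_top : (2 : ℕ∞) ≤ ⊤))
    have hg' : ContDiff ℝ (⊤ : ℕ∞) (iteratedFDeriv ℝ (i + 1) f) :=
      hf.iteratedFDeriv_right (m := ((⊤ : ℕ∞) : WithTop ℕ∞)) (by exact_mod_cast le_top)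
    ext m
    have hcl : DifferentiableAt ℝ (fun y => fderiv ℝ (iteratedFDeriv ℝ i f) y (m 0)) x :=
      (hdg x).clm_apply (differentiableAt_const _)
    rw [iteratedFDeriv_succ_apply_left, funext ih,
      fderiv_clm_apply (hdg x) (differentiableAt_const e),
      ← fderiv_continuousMultilinear_apply_const_apply ((hg'.differentiable (by simp)) x)]
    simp_rw [iteratedFDeriv_succ_apply_left]
    rw [fderiv_continuousMultilinear_apply_const_apply hcl,
      fderiv_clm_apply (hdg x) (differentiableAt_const (m 0))]
    simp [hs (m 0) e]

/-- First-order Taylor expansion, uniformly in the base point. -/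
theorem exists_taylor_bound {E F : Type*} [NormedAddCommGroup E] [NormedSpace ℝ E]
    [NormedAddCommGroup F] [NormedSpace ℝ F] {f : E → F} (hf : ContDiff ℝ (⊤ : ℕ∞) f)
    (hc : HasCompactSupport f) :
    ∃ M, 0 ≤ M ∧ ∀ u v, ‖f (u - v) - f u + fderiv ℝ f u v‖ ≤ M * ‖v‖ ^ 2 := by
  have hd : Differentiable ℝ f := hf.differentiable (by simp)
  have hf' : ContDiff ℝ (⊤ : ℕ∞) (fderiv ℝ f) := hf.fderiv_right (by exact_mod_cast le_top)
  obtain ⟨M, hM⟩ := (hf'.of_le (m := 1)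
    (WithTop.coe_le_coe.2 (le_top : (1 : ℕ∞) ≤ ⊤))).lipschitzWith_of_hasCompactSupport (hc.fderiv ℝ) one_ne_zero
  refine ⟨M, M.2, fun u v => ?_⟩
  have hb : ∀ z ∈ Metric.closedBall u ‖v‖, ‖fderiv ℝ f z - fderiv ℝ f u‖ ≤ M * ‖v‖ := by
    intro z hz
    rw [mem_closedBall_iff_norm] at hz
    exact (hM.norm_sub_le z u).trans (mul_le_mul_of_nonneg_left hz M.2)
  have := (convex_closedBall u ‖v‖).norm_image_sub_le_of_norm_fderiv_le' (𝕜 := ℝ) (f := f)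
    (φ := fderiv ℝ f u) (C := M * ‖v‖) (x := u) (y := u - v)
    (fun z _ => hd z) hb
    (Metric.mem_closedBall_self (norm_nonneg v)) (by simp)
  rw [sub_sub_cancel_left, map_neg, norm_neg, sub_neg_eq_add] at this
  rwa [pow_two, ← mul_assoc]

@[simp] theorem translate_apply (h : ℝ × ℝ) (φ : TestFn) (w : ℝ × ℝ) :
    translate h φ w = φ (w - h) := rfl

theorem lineDerivOp_apply_eq_fderiv (φ : TestFn) (v w : ℝ × ℝ) : (∂_{v} φ) w = fderiv ℝ φ w v := by
  rw [TestFunction.lineDerivOp_eq_lineDerivCLM (𝕜 := ℝ), TestFunction.lineDerivCLM_apply_of_le (𝕜 := ℝ) (by simp)]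
  exact ((φ.contDiff.differentiable (by simp)) w).lineDeriv_eq_fderiv

/-- First-order Taylor expansion of `v ↦ ξ(φ(· - v))` at `0`. The Taylor remainders of `φ` for
`‖v‖ ≤ 1` are supported in one compact set, on which `ξ` is bounded by finitely many of the
seminorms `sup |Dⁱ ·|`; each of these is `O(‖v‖²)` on the remainder. -/
theorem exists_translate_bound (ξ : Distr) (φ : TestFn) :
    ∃ C, ∀ v : ℝ × ℝ, ‖v‖ ≤ 1 → ‖ξ (translate v φ) - ξ φ + ξ (∂_{v} φ)‖ ≤ C * ‖v‖ ^ 2 := by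
  have hφ : ContDiff ℝ (⊤ : ℕ∞) (φ : ℝ × ℝ → ℝ) := φ.contDiff
  have hφc := φ.hasCompactSupport
  let S : Compacts (ℝ × ℝ) := ⟨Metric.cthickening 1 (tsupport φ), hφc.isCompact.cthickening⟩
  let r : ℝ × ℝ → ℝ × ℝ → ℝ := fun v w => φ (w - v) - φ w + fderiv ℝ φ w v
  have hr : ∀ v, ContDiff ℝ (⊤ : ℕ∞) (r v) := fun v =>
    ((hφ.comp (by fun_prop)).sub hφ).add
      ((hφ.fderiv_right (m := ((⊤ : ℕ∞) : WithTop ℕ∞)) (by simp)).clm_apply contDiff_const)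
  have hsupp : ∀ v, ‖v‖ ≤ 1 → Function.support (r v) ⊆ S := by
    intro v hv w hw
    by_contra hcon
    have hcon' : w ∉ Metric.cthickening 1 (tsupport φ) := hcon
    have h1 : w ∉ tsupport φ := fun h => hcon' (Metric.self_subset_cthickening _ h)
    have h2 : w - v ∉ tsupport φ := fun h =>
      hcon' (Metric.mem_cthickening_of_dist_le w _ 1 _ h (by simpa [dist_eq_norm] using hv))
    have h3 : fderiv ℝ φ w = 0 :=
      image_eq_zero_of_notMem_tsupport (fun h => h1 (tsupport_fderiv_subset ℝ h))
    exact hw (by simp [r, image_eq_zero_of_notMem_tsupport h1,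
      image_eq_zero_of_notMem_tsupport h2, h3])
  -- the seminorm `|ξ ·|` on functions supported in `S`
  let ι := TestFunction.ofSupportedInCLM ℝ (F := ℝ) (n := ⊤) (K := S)
    (Ω := (⊤ : Opens (ℝ × ℝ))) (Set.subset_univ _)
  let q : Seminorm ℝ 𝓓_{S}(ℝ × ℝ, ℝ) :=
    (normSeminorm ℝ ℝ).comp ((ξ.toLinearMap).comp ι.toLinearMap)
  have hq : Continuous q := by
    change Continuous fun f => ‖ξ (ι f)‖
    exact (ξ.continuous.comp ι.continuous).norm
  obtain ⟨s, C, -, hC⟩ := Seminorm.bound_of_continuous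
    (ContDiffMapSupportedIn.withSeminorms ℝ (ℝ × ℝ) ℝ ⊤ S) q hq
  have hi : ∀ i : ℕ, ContDiff ℝ (⊤ : ℕ∞) (iteratedFDeriv ℝ i φ) := fun i =>
    hφ.iteratedFDeriv_right (m := ((⊤ : ℕ∞) : WithTop ℕ∞)) (by exact_mod_cast le_top)
  choose M hM0 hM using fun i : ℕ => exists_taylor_bound (hi i) (hφc.iteratedFDeriv (𝕜 := ℝ) i)
  refine ⟨C * ∑ i ∈ s, M i, fun v hv => ?_⟩
  let R : 𝓓_{S}(ℝ × ℝ, ℝ) := ContDiffMapSupportedIn.of_support_subset (hr v) (hsupp v hv)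
  have hR : translate v φ - φ + ∂_{v} φ = ι R := by
    ext w
    simp only [TestFunction.instIsAddApply.add_apply, TestFunction.instIsSubApply.sub_apply,
      lineDerivOp_apply_eq_fderiv, translate_apply]
    rfl
  have hsemi : ∀ i, ContDiffMapSupportedIn.seminorm ℝ (ℝ × ℝ) ℝ ⊤ S i R ≤ M i * ‖v‖ ^ 2 := by
    intro i
    rw [ContDiffMapSupportedIn.seminorm_top_le_iff ℝ (by have := hM0 i; positivity)]
    intro w _
    have e : iteratedFDeriv ℝ i R w = iteratedFDeriv ℝ i φ (w - v) - iteratedFDeriv ℝ i φ w +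
        fderiv ℝ (iteratedFDeriv ℝ i φ) w v := by
      have h1 : ContDiff ℝ (⊤ : ℕ∞) fun w => φ (w - v) := hφ.comp (by fun_prop)
      have h2 : ContDiff ℝ (⊤ : ℕ∞) fun w => fderiv ℝ φ w v :=
        (hφ.fderiv_right (m := ((⊤ : ℕ∞) : WithTop ℕ∞)) (by simp)).clm_apply contDiff_const
      change iteratedFDeriv ℝ i (((fun w => φ (w - v)) - (φ : ℝ × ℝ → ℝ)) + fun w => fderiv ℝ φ w v) w = _
      have h3 : ContDiff ℝ (⊤ : ℕ∞) ((fun w => φ (w - v)) - (φ : ℝ × ℝ → ℝ)) := h1.sub hφ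
      have hle : (i : WithTop ℕ∞) ≤ ((⊤ : ℕ∞) : WithTop ℕ∞) := by exact_mod_cast le_top
      rw [iteratedFDeriv_add_apply (h3.of_le hle).contDiffAt (h2.of_le hle).contDiffAt,
        iteratedFDeriv_sub_apply (h1.of_le hle).contDiffAt (hφ.of_le hle).contDiffAt,
        iteratedFDeriv_comp_sub, iteratedFDeriv_fderiv_apply hφ]
    rw [e]
    exact hM i w v
  have hq' : ‖ξ (translate v φ) - ξ φ + ξ (∂_{v} φ)‖ = q R := by
    rw [← map_sub, ← map_add, hR]; rfl
  rw [hq']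
  calc q R ≤ (C • s.sup (ContDiffMapSupportedIn.seminorm ℝ (ℝ × ℝ) ℝ ⊤ S)) R := hC R
    _ ≤ C * ∑ i ∈ s, ContDiffMapSupportedIn.seminorm ℝ (ℝ × ℝ) ℝ ⊤ S i R := by
        rw [smul_apply]
        change (C : ℝ) * _ ≤ _
        gcongr
        have := Seminorm.finset_sup_le_sum (ContDiffMapSupportedIn.seminorm ℝ (ℝ × ℝ) ℝ ⊤ S) s R
        simpa using this
    _ ≤ C * ∑ i ∈ s, M i * ‖v‖ ^ 2 := by gcongr; exact hsemi _
    _ = C * (∑ i ∈ s, M i) * ‖v‖ ^ 2 := by rw [← Finset.sum_mul]; ring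

theorem translate_add (y v : ℝ × ℝ) (φ : TestFn) :
    translate (y + v) φ = translate v (translate y φ) := by
  ext w; simp [sub_sub, add_comm]

theorem lineDeriv_translate (y v : ℝ × ℝ) (φ : TestFn) :
    ∂_{v} (translate y φ) = translate y (∂_{v} φ) := by
  ext w
  rw [translate_apply, lineDerivOp_apply_eq_fderiv, lineDerivOp_apply_eq_fderiv]
  change fderiv ℝ (fun w => φ (w - y)) w v = _
  rw [fderiv_comp_sub]

theorem hasFDerivAt_translate (ξ : Distr) (φ : TestFn) (y : ℝ × ℝ) :
    HasFDerivAt (fun y => ξ (translate y φ))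
      (-(ξ (translate y (∂_{((1, 0) : ℝ × ℝ)} φ)) • ContinuousLinearMap.fst ℝ ℝ ℝ +
        ξ (translate y (∂_{((0, 1) : ℝ × ℝ)} φ)) • ContinuousLinearMap.snd ℝ ℝ ℝ)) y := by
  obtain ⟨C, hC⟩ := exists_translate_bound ξ (translate y φ)
  rw [hasFDerivAt_iff_isLittleO_nhds_zero]
  have hO : (fun v : ℝ × ℝ => ξ (translate (y + v) φ) - ξ (translate y φ) -
      (-(ξ (translate y (∂_{((1, 0) : ℝ × ℝ)} φ)) • ContinuousLinearMap.fst ℝ ℝ ℝ +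
        ξ (translate y (∂_{((0, 1) : ℝ × ℝ)} φ)) • ContinuousLinearMap.snd ℝ ℝ ℝ)) v)
      =O[nhds 0] fun v => ‖v‖ ^ 2 := by
    refine Asymptotics.IsBigO.of_bound C ?_
    filter_upwards [Metric.closedBall_mem_nhds (0 : ℝ × ℝ) one_pos] with v hv
    have hv' : v = v.1 • ((1, 0) : ℝ × ℝ) + v.2 • ((0, 1) : ℝ × ℝ) := by ext <;> simp
    have hlin : ∂_{v} (translate y φ) = v.1 • translate y (∂_{((1, 0) : ℝ × ℝ)} φ) +
        v.2 • translate y (∂_{((0, 1) : ℝ × ℝ)} φ) := by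
      conv_lhs => rw [hv']
      rw [LineDeriv.lineDerivOp_left_add, LineDeriv.lineDerivOp_left_smul,
        LineDeriv.lineDerivOp_left_smul, lineDeriv_translate, lineDeriv_translate]
    have h := hC v (by simpa using hv)
    rw [hlin, map_add, map_smul, map_smul, ← translate_add] at h
    rw [norm_pow, norm_norm]
    refine le_trans (le_of_eq ?_) h
    congr 1
    simp only [neg_apply, add_apply,
      smul_apply, ContinuousLinearMap.coe_fst', ContinuousLinearMap.coe_snd',
      smul_eq_mul]
    ring
  refine hO.trans_isLittleO ?_
  exact (Asymptotics.isLittleO_norm_pow_id one_lt_two)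

theorem contDiff_translate (ξ : Distr) (φ : TestFn) :
    ContDiff ℝ (⊤ : ℕ∞) fun y => ξ (translate y φ) := by
  rw [contDiff_infty]
  intro n
  induction n generalizing φ with
  | zero =>
    exact contDiff_zero.2 (continuous_iff_continuousAt.2 fun y =>
      (hasFDerivAt_translate ξ φ y).continuousAt)
  | succ n ih =>
    push_cast
    rw [contDiff_succ_iff_hasFDerivAt]
    exact ⟨_, (((ih _).smul contDiff_const).add ((ih _).smul contDiff_const)).neg,
      hasFDerivAt_translate ξ φ⟩

theorem contDiff_mollNoise {Ω : Type*} (ρ : TestFn) (ξ : Ω → Distr) (ε : ℝ) (hε : 0 < ε) (ω : Ω) :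
    ContDiff ℝ (⊤ : ℕ∞) (mollNoise ρ ξ ε hε ω) := by
  have h : mollNoise ρ ξ ε hε ω = fun y => ξ ω (translate y (mollAt ρ ε hε 0)) := by
    funext y
    unfold mollNoise
    congr 1
    ext w
    change rescale ρ ε (y - w) = rescale ρ ε (0 - (w - y))
    simp
  rw [h]
  exact contDiff_translate _ _

end TestFunctions

/-! ### The truncated heat kernel -/

theorem heatKernel_eq_gaussianPDFReal {t : ℝ} (ht : 0 < t) (x : ℝ) :
    heatKernel (t, x) = gaussianPDFReal 0 (2 * t).toNNReal x := by
  have h : ((2 * t).toNNReal : ℝ) = 2 * t := Real.coe_toNNReal _ (by positivity)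
  rw [gaussianPDFReal, heatKernel, if_pos ht, h, div_eq_inv_mul]
  ring_nf

theorem measurable_heatKernel : Measurable heatKernel := by
  unfold heatKernel
  refine Measurable.ite (measurableSet_lt measurable_const measurable_fst) ?_ measurable_const
  fun_prop

theorem heatKernel_nonneg (z : ℝ × ℝ) : 0 ≤ heatKernel z := by
  unfold heatKernel
  split_ifs <;> positivity

/-- Each time slice of the heat kernel is a probability density or zero. -/
theorem integrable_heatKernel_slab (M : ℝ) :
    Integrable heatKernel ((volume.restrict (Set.Icc (-M) M)).prod (volume : Measure ℝ)) := by
  have hslice : ∀ t : ℝ, Integrable (fun x => heatKernel (t, x)) ∧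
      ∫ x, ‖heatKernel (t, x)‖ = if 0 < t then 1 else 0 := by
    intro t
    by_cases ht : 0 < t
    · have hv : (2 * t).toNNReal ≠ 0 := by simpa using ht
      simp_rw [Real.norm_of_nonneg (heatKernel_nonneg _), heatKernel_eq_gaussianPDFReal ht,
        integral_gaussianPDFReal_eq_one 0 hv, if_pos ht]
      exact ⟨integrable_gaussianPDFReal _ _, trivial⟩
    · have : ∀ x, heatKernel (t, x) = 0 := fun x => if_neg ht
      simp [this, ht]
  rw [integrable_prod_iff measurable_heatKernel.aestronglyMeasurable]
  refine ⟨.of_forall fun t => (hslice t).1, ?_⟩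
  simp only [(hslice _).2]
  refine Integrable.of_bound (Measurable.ite measurableSet_Ioi measurable_const
    measurable_const).aestronglyMeasurable 1 (.of_forall fun t => ?_)
  change ‖if 0 < t then (1 : ℝ) else 0‖ ≤ 1
  split_ifs <;> simp

theorem integrableOn_heatKernel {S : Set (ℝ × ℝ)} (hS : IsCompact S) :
    IntegrableOn heatKernel S := by
  obtain ⟨M, hM⟩ := hS.isBounded.subset_closedBall 0
  have h : IntegrableOn heatKernel (Set.Icc (-M) M ×ˢ (Set.univ : Set ℝ)) := by
    have := integrable_heatKernel_slab M
    rw [IntegrableOn, Measure.volume_eq_prod, ← Measure.prod_restrict]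
    rwa [Measure.restrict_univ]
  refine h.mono_set fun z hz => ?_
  have hz' := hM hz
  rw [mem_closedBall_zero_iff] at hz'
  exact ⟨abs_le.1 ((norm_fst_le z).trans hz'), Set.mem_univ _⟩

namespace IsTruncatedHeatKernel

theorem measurable {K : ℝ × ℝ → ℝ} (hK : IsTruncatedHeatKernel K) : Measurable K := by
  obtain ⟨R, hR, h⟩ := hK.decomposition
  have : K = fun z => if z = 0 then K 0 else heatKernel z - R z := by
    funext z
    split_ifs with hz
    · rw [hz]
    · rw [h z hz]; ring
  rw [this]
  exact Measurable.ite (measurableSet_singleton 0) measurable_const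
    (measurable_heatKernel.sub hR.continuous.measurable)

theorem integrable {K : ℝ × ℝ → ℝ} (hK : IsTruncatedHeatKernel K) : Integrable K := by
  obtain ⟨R, hR, h⟩ := hK.decomposition
  rw [← integrableOn_iff_integrable_of_support_subset (subset_tsupport K)]
  have hS : IsCompact (tsupport K) := hK.compact
  refine ((integrableOn_heatKernel hS).sub (hR.continuous.continuousOn.integrableOn_compact
    hS)).congr ?_
  have h0 : ∀ᵐ z : ℝ × ℝ, z ≠ 0 := by
    simp [ae_iff]
  filter_upwards [ae_restrict_of_ae h0] with z hz
  change heatKernel z - R z = K z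
  rw [h z hz]; ring

end IsTruncatedHeatKernel

/-- Convolution with a compactly supported integrable kernel preserves smooth functions, which need
not have compact support: near a given point, only the values of `f` on a bounded set matter. -/
theorem contDiff_conv {K f : ℝ × ℝ → ℝ} (hK : Integrable K) (hKc : HasCompactSupport K)
    (hf : ContDiff ℝ (⊤ : ℕ∞) f) : ContDiff ℝ (⊤ : ℕ∞) (conv K f) := by
  rw [contDiff_iff_contDiffAt]
  intro z₀
  obtain ⟨M, hM⟩ := hKc.isCompact.isBounded.subset_closedBall 0
  -- a cutoff equal to one on the part of the plane that `conv K f` sees from the unit ball at `z₀`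
  let χ : ContDiffBump z₀ := ⟨|M| + 1, |M| + 2, by positivity, by linarith⟩
  have hg : ContDiff ℝ (⊤ : ℕ∞) fun z => χ z * f z := χ.contDiff.mul hf
  have hgc : HasCompactSupport fun z => χ z * f z := χ.hasCompactSupport.mul_right
  have h := (hgc.contDiff_convolution_right (ContinuousLinearMap.mul ℝ ℝ)
    hK.locallyIntegrable hg).contDiffAt (x := z₀)
  refine h.congr_of_eventuallyEq ?_
  filter_upwards [Metric.ball_mem_nhds z₀ one_pos] with z hz
  unfold conv
  rw [convolution_def, convolution_def]
  congr 1
  funext w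
  by_cases hw : w ∈ tsupport K
  · have hw' := hM hw
    rw [mem_closedBall_zero_iff] at hw'
    have : χ (z - w) = 1 := by
      refine χ.one_of_mem_closedBall ?_
      rw [mem_closedBall_iff_norm]
      rw [mem_ball_iff_norm] at hz
      change ‖z - w - z₀‖ ≤ |M| + 1
      have h1 : ‖z - w - z₀‖ ≤ ‖z - z₀‖ + ‖w‖ := by
        rw [sub_right_comm]; exact norm_sub_le _ _
      linarith [le_abs_self M]
    simp [this]
  · simp [image_eq_zero_of_notMem_tsupport hw]

/-! ### Weight and sign of multi-indices -/

/-- Contribution of a variable to the weight: `2` for a noise variable, `2 - l` for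
`z_(0, k e_(0,0) + l e_(0,1))` and `‖n‖` for `z_n`. The operator `D⁽ⁿ⁾` lowers the weight by `‖n‖`. -/
def varWeight : Var → ℕ
  | .inl (.noise _) => 2
  | .inl (.drift _ l) => 2 - l
  | .inr n => pdeg n.1

/-- The weight of a multi-index, along which the vanishing of the constants is proved. -/
def weight : MI →+ ℕ := Finsupp.weight varWeight

/-- The sign which a variable picks up when the driving function `η` is replaced by `a η(t, b x)`. -/
def varSign (a b : ℤˣ) : Var → ℤˣ
  | .inl (.noise _) => a
  | .inl (.drift _ l) => b ^ (l : ℕ)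
  | .inr n => b ^ n.1.2

/-- The sign `σ(β)` of a multi-index, extending `varSign` multiplicatively to the monomials `z^β`. -/
def sign (a b : ℤˣ) (β : MI) : ℤˣ := β.prod fun v k => varSign a b v ^ k

@[simp] theorem sign_zero (a b : ℤˣ) : sign a b 0 = 1 := Finsupp.prod_zero_index

theorem sign_add (a b : ℤˣ) (β γ : MI) : sign a b (β + γ) = sign a b β * sign a b γ :=
  Finsupp.prod_add_index' (by simp) (by simp [pow_add])

theorem sign_sum (a b : ℤˣ) {ι : Type*} (s : Finset ι) (f : ι → MI) :
    sign a b (∑ i ∈ s, f i) = ∏ i ∈ s, sign a b (f i) := by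
  classical
  induction s using Finset.induction_on with
  | empty => simp
  | insert i s hi ih => rw [Finset.sum_insert hi, Finset.prod_insert hi, sign_add, ih]

@[simp] theorem sign_single (a b : ℤˣ) (v : Var) (k : ℕ) :
    sign a b (Finsupp.single v k) = varSign a b v ^ k :=
  Finsupp.prod_single_index (by simp)

@[simp] theorem weight_single (v : Var) (k : ℕ) :
    weight (Finsupp.single v k) = k * varWeight v := by
  simp [weight, Finsupp.weight_apply]

theorem weight_raise {n : ℕ × ℕ} (hn : n = (0, 0) ∨ n = (0, 1)) {v : Var} {u : MI}
    (hu : coeff u (raise n v) ≠ 0) (a b : ℤˣ) :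
    weight u + pdeg n = varWeight v ∧ sign a b u = b ^ n.2 * varSign a b v := by
  have hX : ∀ (r : ℝ) (x : Var), coeff u (C r * X x) ≠ 0 → u = Finsupp.single x 1 := by
    intro r x h
    by_contra hne
    rw [coeff_C_mul, coeff_X, if_neg (Ne.symm hne)] at h
    simp at h
  have hbb : b * b = 1 := Int.units_mul_self b
  rcases v with (m | ⟨k, l⟩) | ⟨m, hm⟩ <;> rcases hn with rfl | rfl
  · simp only [raise, if_true] at hu
    rw [hX _ _ hu]; simp [varWeight, varSign, pdeg]
  · simp [raise] at hu
  · simp only [raise, if_true] at hu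
    rw [hX _ _ hu]; simp [varWeight, varSign, pdeg]
  · have h01 : ((0, 1) : ℕ × ℕ) ≠ (0, 0) := by simp
    simp only [raise, if_neg h01, if_true] at hu
    split_ifs at hu with hl
    · rw [hX _ _ hu]
      simp only [weight_single, sign_single, varWeight, varSign, pdeg, pow_succ, pow_zero, one_mul]
      exact ⟨by omega, mul_comm _ _⟩
    · simp at hu
  · rw [show raise (0, 0) (Sum.inr ⟨m, hm⟩) = 0 from if_neg hm] at hu
    simp at hu
  · simp only [raise] at hu
    split_ifs at hu with hm'
    · rw [coeff_one] at hu
      have : u = 0 := by by_contra h; simp [Ne.symm h] at hu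
      subst this
      subst hm'
      simp [varWeight, varSign, pdeg, hbb]
    · simp at hu

theorem exists_of_coeff_D {n : ℕ × ℕ} (hn : n = (0, 0) ∨ n = (0, 1)) {c : MvPolynomial Var ℝ}
    {β : MI} (h : coeff β (D n c) ≠ 0) (a b : ℤˣ) :
    ∃ β' ∈ c.support, weight β + pdeg n = weight β' ∧ sign a b β * b ^ n.2 = sign a b β' := by
  rw [c.as_sum, map_sum, coeff_sum] at h
  obtain ⟨β', hβ', h⟩ := Finset.exists_ne_zero_of_sum_ne_zero h
  refine ⟨β', hβ', ?_⟩
  rw [D, mkDerivation_monomial, coeff_smul, Finsupp.sum, coeff_sum] at h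
  obtain ⟨v, hv, h⟩ := Finset.exists_ne_zero_of_sum_ne_zero (right_ne_zero_of_mul h)
  rw [smul_eq_mul, coeff_monomial_mul'] at h
  split_ifs at h with hle
  · obtain ⟨hw, hs⟩ := weight_raise hn (right_ne_zero_of_mul h) a b
    have hv1 : Finsupp.single v 1 ≤ β' := by
      simpa [Nat.one_le_iff_ne_zero] using hv
    obtain ⟨γ, rfl⟩ := exists_add_of_le hv1
    simp only [add_tsub_cancel_left] at hle hw hs
    obtain ⟨u, rfl⟩ := exists_add_of_le hle
    simp only [add_tsub_cancel_left] at hw hs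
    have hbb : b ^ n.2 * b ^ n.2 = 1 := Int.units_mul_self _
    simp only [map_add, weight_single, sign_add, sign_single, hs, one_mul, pow_one]
    refine ⟨by omega, ?_⟩
    calc sign a b γ * (b ^ n.2 * varSign a b v) * b ^ n.2
        = sign a b γ * varSign a b v * (b ^ n.2 * b ^ n.2) := by ac_rfl
      _ = _ := by rw [hbb, mul_one, mul_comm]
  · simp at h

theorem exists_of_coeff_iterD {l : ℕ} {n : Fin l → ℕ × ℕ} (hn : ∀ i, n i = (0, 0) ∨ n i = (0, 1))
    {c : MvPolynomial Var ℝ} {β : MI} (h : coeff β (iterD n c) ≠ 0) (a b : ℤˣ) :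
    ∃ β' ∈ c.support, weight β + ∑ i, pdeg (n i) = weight β' ∧
      sign a b β * ∏ i, b ^ (n i).2 = sign a b β' := by
  induction l generalizing β with
  | zero =>
    exact ⟨β, by simpa [iterD] using h, by simp, by simp⟩
  | succ l ih =>
    have e : iterD n c = D (n 0) (iterD (fun i => n i.succ) c) := by
      simp [iterD, List.ofFn_succ]
    rw [e] at h
    obtain ⟨γ, hγ, hw, hs⟩ := exists_of_coeff_D (hn 0) h a b
    obtain ⟨β', hβ', hw', hs'⟩ := ih (fun i => hn i.succ) (mem_support_iff.1 hγ)
    refine ⟨β', hβ', ?_, ?_⟩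
    · rw [Fin.sum_univ_succ, ← hw', ← hw, add_assoc]
    · rw [Fin.prod_univ_succ, ← hs', ← hs, mul_assoc]

/-- A nonzero coefficient in `(Γ* c)(β)` comes from a monomial of `c` whose weight and sign are
determined by those of `β` and of the attached multi-indices. -/
theorem exists_of_coeff_prod_mul_iterD {l : ℕ} {n : Fin l → ℕ × ℕ} {g : Fin l → MI}
    (hn : ∀ i, n i = (0, 0) ∨ n i = (0, 1)) {c : MvPolynomial Var ℝ} {β : MI}
    (h : coeff β ((∏ i, monomial (g i) 1) * iterD n c) ≠ 0) (a b : ℤˣ) :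
    ∃ β' ∈ c.support, weight β + ∑ i, pdeg (n i) = ∑ i, weight (g i) + weight β' ∧
      sign a b β * ∏ i, b ^ (n i).2 = (∏ i, sign a b (g i)) * sign a b β' := by
  have e : (∏ i, monomial (g i) 1 : MvPolynomial Var ℝ) = monomial (∑ i, g i) 1 := by
    rw [monomial_sum_one]
  rw [e, coeff_monomial_mul'] at h
  split_ifs at h with hle
  · obtain ⟨γ, rfl⟩ := exists_add_of_le hle
    rw [add_tsub_cancel_left, one_mul] at h
    obtain ⟨β', hβ', hw, hs⟩ := exists_of_coeff_iterD hn h a b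
    refine ⟨β', hβ', ?_, ?_⟩
    · rw [map_add, map_sum, ← hw, add_assoc]
    · rw [sign_add, sign_sum, ← hs, mul_assoc]
  · simp at h

/-! ### Covariance of the canonical model -/

/-- A sign, as a real number. -/
def unitSign : ℤˣ →* ℝ := (Int.castRingHom ℝ : ℤ →* ℝ).comp (Units.coeHom ℤ)

theorem unitSign_neg_one : unitSign (-1) = -1 := by simp [unitSign]

theorem unitSign_mul_self (a : ℤˣ) : unitSign a * unitSign a = 1 := by
  rw [← map_mul, Int.units_mul_self, map_one]

/-- The map `(t, x) ↦ (t, b x)` of the plane, for a sign `b`. -/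
def spaceFlip (b : ℤˣ) (z : ℝ × ℝ) : ℝ × ℝ := (z.1, unitSign b * z.2)

/-- The action `(S η)(t, x) = a η(t, b x)` of a pair of signs on functions of the plane. -/
def act (a b : ℤˣ) (η : ℝ × ℝ → ℝ) (z : ℝ × ℝ) : ℝ := unitSign a * η (spaceFlip b z)

theorem tay_zero (f : ℝ × ℝ → ℝ) (z : ℝ × ℝ) : tay (0, 0) f z = f z := by
  simp [tay, pd]

theorem tay_one (f : ℝ × ℝ → ℝ) (z : ℝ × ℝ) :
    tay (0, 1) f z = deriv (fun y => f (z.1, y)) z.2 := by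
  simp [tay, pd]

theorem tay_covariant {n : ℕ × ℕ} (hn : n = (0, 0) ∨ n = (0, 1)) {f g : ℝ × ℝ → ℝ} (b s : ℤˣ)
    (h : ∀ z, g z = unitSign s * f (spaceFlip b z)) (z : ℝ × ℝ) :
    tay n g z = unitSign (s * b ^ n.2) * tay n f (spaceFlip b z) := by
  rcases hn with rfl | rfl
  · simp [tay_zero, h]
  · rw [tay_one, tay_one]
    have e : (fun y => g (z.1, y)) = fun y => unitSign s * (fun y => f (z.1, y)) (unitSign b * y) :=
      funext fun y => h _
    rw [e, deriv_const_mul_field, deriv_comp_mul_left (unitSign b) (fun y => f (z.1, y))]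
    simp [spaceFlip, mul_assoc]

theorem conv_spaceFlip {K : ℝ × ℝ → ℝ} (hK : ∀ t x, K (t, -x) = K (t, x)) (b : ℤˣ) (f : ℝ × ℝ → ℝ)
    (z : ℝ × ℝ) : conv K (fun w => f (spaceFlip b w)) z = conv K f (spaceFlip b z) := by
  unfold conv
  rw [convolution_def, convolution_def]
  rcases Int.units_eq_one_or b with rfl | rfl
  · have : ∀ w, spaceFlip 1 w = w := fun w => by simp [spaceFlip]
    simp [this]
  · have hmp : MeasurePreserving (Prod.map id Neg.neg : ℝ × ℝ → ℝ × ℝ) :=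
      (MeasurePreserving.id volume).prod (Measure.measurePreserving_neg volume)
    have hme : MeasurableEmbedding (Prod.map id Neg.neg : ℝ × ℝ → ℝ × ℝ) :=
      ((Homeomorph.refl ℝ).prodCongr (Homeomorph.neg ℝ)).measurableEmbedding
    rw [← hmp.integral_comp hme]
    congr 1
    funext w
    simp only [spaceFlip, unitSign_neg_one, Prod.map, hK, id]
    congr 2
    ext <;> simp
    ring

theorem conv_const_mul (K f : ℝ × ℝ → ℝ) (r : ℝ) (z : ℝ × ℝ) :
    conv K (fun w => r * f w) z = r * conv K f z := by
  unfold conv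
  rw [convolution_def, convolution_def, ← integral_const_mul]
  congr 1
  funext w
  simp only [ContinuousLinearMap.mul_apply']
  ring

theorem integrate_eq_zero {β : MI} (hT : β ∉ T) (hn : ¬∃ n, β = Finsupp.single (Sum.inr n) 1)
    (K g : ℝ × ℝ → ℝ) : integrate K β g = 0 := by
  rw [integrate, dif_neg hn, if_neg hT]; rfl

theorem integrate_single (n : {n : ℕ × ℕ // n ≠ 0}) (K g : ℝ × ℝ → ℝ) (z : ℝ × ℝ) :
    integrate K (Finsupp.single (Sum.inr n) 1) g z = z.1 ^ n.1.1 * z.2 ^ n.1.2 := by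
  have h : ∃ m : {n : ℕ × ℕ // n ≠ 0},
    (Finsupp.single (Sum.inr n) 1 : MI) = Finsupp.single (Sum.inr m) 1 := ⟨n, rfl⟩
  rw [integrate, dif_pos h]
  have := h.choose_spec
  rw [Finsupp.single_left_inj one_ne_zero] at this
  rw [← Sum.inr_injective this]

theorem integrate_covariant {K : ℝ × ℝ → ℝ} (hK : ∀ t x, K (t, -x) = K (t, x)) (a b : ℤˣ) (β : MI)
    {f g : ℝ × ℝ → ℝ} (h : ∀ z, g z = unitSign (sign a b β) * f (spaceFlip b z)) (z : ℝ × ℝ) :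
    integrate K β g z = unitSign (sign a b β) * integrate K β f (spaceFlip b z) := by
  by_cases hn : ∃ n, β = Finsupp.single (Sum.inr n) 1
  · obtain ⟨n, rfl⟩ := hn
    rw [integrate_single, integrate_single]
    simp only [sign_single, varSign, pow_one, spaceFlip, mul_pow, map_pow]
    have : (unitSign b ^ n.1.2) * (unitSign b ^ n.1.2) = 1 := by
      rw [← mul_pow, unitSign_mul_self, one_pow]
    linear_combination (-(z.1 ^ n.1.1 * z.2 ^ n.1.2)) * this
  · by_cases hT : β ∈ T
    · rw [integrate, dif_neg hn, if_pos hT, integrate, dif_neg hn, if_pos hT, funext h,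
        conv_const_mul, conv_spaceFlip hK]
    · simp [integrate_eq_zero hT hn]

theorem slotDeriv_eq (v : Node) (i : v.Slot) :
    v.slotDeriv i = (0, 0) ∨ v.slotDeriv i = (0, 1) := by
  rcases i with i | i <;> simp [Node.slotDeriv]

theorem prod_slotDeriv (v : Node) (x : ℤˣ) :
    ∏ i, x ^ (v.slotDeriv i).2 = x ^ v.mult (0, 1) := by
  simp [Fintype.prod_sum_type, Node.slotDeriv]

theorem canonRHS_covariant (a b : ℤˣ) (η : ℝ × ℝ → ℝ) {Φ Ψ : MI → ℝ × ℝ → ℝ}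
    (h : ∀ γ z, Ψ γ z = unitSign (sign a b γ) * Φ γ (spaceFlip b z)) (β : MI) (z : ℝ × ℝ) :
    canonRHS (act a b η) Ψ β z = unitSign (sign a b β) * canonRHS η Φ β (spaceFlip b z) := by
  unfold canonRHS
  rw [Finset.mul_sum]
  refine Finset.sum_congr rfl fun w hw => ?_
  rcases w with v | n
  · simp only
    rw [Finset.mul_sum]
    refine Finset.sum_congr rfl fun g hg => ?_
    have hg' : ∑ i, g i = β - Finsupp.single (.inl v) 1 := (Finset.mem_piAntidiag.1 hg).1
    have hv1 : Finsupp.single (.inl v) 1 ≤ β := by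
      simpa [Nat.one_le_iff_ne_zero] using hw
    have hβ : sign a b β = varSign a b (.inl v) * ∏ i, sign a b (g i) := by
      rw [← sign_sum, hg']
      conv_lhs => rw [← add_tsub_cancel_of_le hv1]
      rw [sign_add, sign_single, pow_one]
    have hsrc : (∏ i, unitSign (b ^ (v.slotDeriv i).2)) * v.source (act a b η) z =
        unitSign (varSign a b (.inl v)) * v.source η (spaceFlip b z) := by
      rw [← map_prod, prod_slotDeriv]
      rcases v with m | ⟨k, l⟩
      · simp [Node.source, act, varSign, Node.mult]
      · simp [Node.source, varSign, Node.mult]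
    rw [Finset.prod_congr rfl fun i _ =>
      tay_covariant (slotDeriv_eq v i) b (sign a b (g i)) (h (g i)) z]
    simp only [map_mul] at hsrc ⊢
    rw [Finset.prod_mul_distrib, Finset.prod_mul_distrib, hβ, map_mul, map_prod]
    linear_combination (∏ i, unitSign (sign a b (g i))) *
      (∏ i, tay (v.slotDeriv i) (Φ (g i)) (spaceFlip b z)) * hsrc
  · simp

theorem canon_covariant {K : ℝ × ℝ → ℝ} (hK : ∀ t x, K (t, -x) = K (t, x)) (a b : ℤˣ)
    (η : ℝ × ℝ → ℝ) (β : MI) (z : ℝ × ℝ) :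
    canon K (act a b η) β z = unitSign (sign a b β) * canon K η β (spaceFlip b z) := by
  induction β using WellFoundedLT.induction generalizing z with
  | ind β ih =>
    rw [canon, canon]
    refine integrate_covariant hK a b β (fun z => ?_) z
    refine canonRHS_covariant a b η (fun γ z => ?_) β z
    split_ifs with hγ
    · exact ih γ hγ z
    · simp

theorem canonMinus_covariant {K : ℝ × ℝ → ℝ} (hK : ∀ t x, K (t, -x) = K (t, x)) (a b : ℤˣ)
    (η : ℝ × ℝ → ℝ) (β : MI) (z : ℝ × ℝ) :
    canonMinus K (act a b η) β z = unitSign (sign a b β) * canonMinus K η β (spaceFlip b z) :=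
  canonRHS_covariant a b η (canon_covariant hK a b η) β z

/-! ### Covariance of the renormalised model -/

/-- The family `Φ` has no components besides those in `T` and the polynomial ones, as is the case for
`Π^c`. -/
def VanishesOffT (Φ : MI → ℝ × ℝ → ℝ) : Prop :=
  ∀ γ, γ ∉ T → (¬∃ n, γ = Finsupp.single (Sum.inr n) 1) → Φ γ = 0

/-- Every element of `T` has a noise variable. -/
theorem two_le_weight {γ : MI} (h : γ ∈ T) : 2 ≤ weight γ := by
  have h1 : 2 * noiseCount γ ≤ weight γ := by
    rw [noiseCount, weight, Finsupp.weight_apply, Finsupp.sum, Finsupp.sum, Finset.mul_sum]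
    refine Finset.sum_le_sum fun v _ => ?_
    rcases v with (m | ⟨k, l⟩) | n <;> simp [varNoise, varWeight, mul_comm]
  have := h.2
  omega

/-- A component attached by `Γ*` has weight at least `‖n‖ + 1`. For `n = (0,1)` this is where leaving out
the pair `z^γ = z_n` matters. -/
theorem jet_eq_zero {Φ : MI → ℝ × ℝ → ℝ} (hΦ : VanishesOffT Φ) {n : ℕ × ℕ}
    (hn : n = (0, 0) ∨ n = (0, 1)) {γ : MI} (h : weight γ ≤ pdeg n) (z : ℝ × ℝ) :
    jet Φ n γ z = 0 := by
  unfold jet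
  split_ifs with hex
  · rfl
  by_cases hT : γ ∈ T
  · have := two_le_weight hT
    rcases hn with rfl | rfl <;> simp [pdeg] at h <;> omega
  · have hns : ¬∃ n, γ = Finsupp.single (Sum.inr n) 1 := by
      rintro ⟨⟨m, hm⟩, rfl⟩
      simp only [weight_single, varWeight, one_mul] at h
      have hm' : pdeg m = 0 → m = 0 := by
        intro h0
        simp only [pdeg] at h0
        ext
        · change m.1 = 0; omega
        · change m.2 = 0; omega
      rcases hn with rfl | rfl
      · exact hm (hm' (by simpa [pdeg] using h))
      · refine hex ⟨by simp, ?_⟩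
        congr 2
        ext
        · change m.1 = 0; simp [pdeg] at h; omega
        · change m.2 = 1
          have : pdeg m ≠ 0 := fun h => hm (hm' h)
          simp [pdeg] at h this
          omega
    rw [hΦ γ hT hns]
    rcases hn with rfl | rfl
    · simp [tay_zero]
    · simp [tay_one]

theorem jet_covariant {Φ Ψ : MI → ℝ × ℝ → ℝ} {n : ℕ × ℕ} (hn : n = (0, 0) ∨ n = (0, 1)) (b s : ℤˣ)
    {γ : MI} (h : ∀ z, Ψ γ z = unitSign s * Φ γ (spaceFlip b z)) (z : ℝ × ℝ) :
    jet Ψ n γ z = unitSign (s * b ^ n.2) * jet Φ n γ (spaceFlip b z) := by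
  unfold jet
  split_ifs
  · simp
  · exact tay_covariant hn b s h z

/-- In a nonzero term of `(Γ* c)(β)` with `l` attached components, the monomial `β'` of `c` satisfies
`weight β' + l ≤ weight β`, and the attached multi-indices have weight less than `β` once
`2 ≤ weight β'`. -/
theorem weight_of_coeff_ne_zero {l : ℕ} {n : Fin l → ℕ × ℕ} {g : Fin l → MI}
    (hn : ∀ i, n i = (0, 0) ∨ n i = (0, 1)) (hg : ∀ i, pdeg (n i) < weight (g i))
    {c : MvPolynomial Var ℝ} {β : MI}
    (h : coeff β ((∏ i, monomial (g i) 1) * iterD n c) ≠ 0) (a b : ℤˣ) :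
    ∃ β' ∈ c.support, weight β' + l ≤ weight β ∧ (∀ i, weight (g i) + weight β' ≤ weight β + 1) ∧
      sign a b β * ∏ i, b ^ (n i).2 = (∏ i, sign a b (g i)) * sign a b β' := by
  obtain ⟨β', hβ', hw, hs⟩ := exists_of_coeff_prod_mul_iterD hn h a b
  refine ⟨β', hβ', ?_, fun i => ?_, hs⟩
  · have : ∑ i, (pdeg (n i) + 1) ≤ ∑ i, weight (g i) := Finset.sum_le_sum fun i _ => hg i
    rw [Finset.sum_add_distrib] at this
    simp at this
    omega
  · have h1 : ∑ j ∈ Finset.univ.erase i, pdeg (n j) ≤ ∑ j ∈ Finset.univ.erase i, weight (g j) :=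
      Finset.sum_le_sum fun j _ => (hg j).le
    rw [← Finset.add_sum_erase Finset.univ (fun i => pdeg (n i)) (Finset.mem_univ i),
      ← Finset.add_sum_erase Finset.univ (fun i => weight (g i)) (Finset.mem_univ i)] at hw
    have h2 : pdeg (n i) ≤ 1 := by rcases hn i with h | h <;> simp [h, pdeg]
    omega

/-- The term without `D⁽ⁿ⁾` of `(Γ* c)(β)` is `c_β`. -/
theorem gammaStar_eq (Φ : MI → ℝ × ℝ → ℝ) (c : MvPolynomial Var ℝ) (β : MI) (z : ℝ × ℝ) :
    gammaStar Φ c β z = coeff β c + ∑ l ∈ Finset.range β.degree, ((l + 1).factorial : ℝ)⁻¹ *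
      ∑ n ∈ Fintype.piFinset (fun _ : Fin (l + 1) => ({(0, 0), (0, 1)} : Finset (ℕ × ℕ))),
        ∑ b ∈ Fintype.piFinset (fun _ : Fin (l + 1) => Finset.Icc 0 β),
          (∏ i, jet Φ (n i) (b i) z) * coeff β ((∏ i, monomial (b i) 1) * iterD n c) := by
  rw [gammaStar, Finset.sum_range_succ', add_comm]
  congr 1
  simp [iterD, Fintype.piFinset_of_isEmpty]

/-- If `Φ` is covariant and `c` only charges multi-indices of sign `1`, both below the weight `w`, then
all terms of `(Γ* c)(β)` except `c_β` are covariant for `β` up to the weight `w`. -/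
theorem gammaStar_covariant {Φ Ψ : MI → ℝ × ℝ → ℝ} (hΦ : VanishesOffT Φ) (hΨ : VanishesOffT Ψ)
    {a b : ℤˣ} {c : MvPolynomial Var ℝ} (hcT : ∀ β' ∈ c.support, β' ∈ T) {w : ℕ}
    (hcov : ∀ γ, weight γ < w → ∀ z, Ψ γ z = unitSign (sign a b γ) * Φ γ (spaceFlip b z))
    (hc : ∀ β' ∈ c.support, weight β' < w → sign a b β' = 1) {β : MI} (hβ : weight β ≤ w)
    (z : ℝ × ℝ) : gammaStar Ψ c β z - coeff β c =
      unitSign (sign a b β) * (gammaStar Φ c β (spaceFlip b z) - coeff β c) := by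
  rw [gammaStar_eq, gammaStar_eq, add_sub_cancel_left, add_sub_cancel_left, Finset.mul_sum]
  refine Finset.sum_congr rfl fun l _ => ?_
  rw [mul_left_comm]
  congr 1
  rw [Finset.mul_sum]
  refine Finset.sum_congr rfl fun n hn => ?_
  rw [Finset.mul_sum]
  refine Finset.sum_congr rfl fun g _ => ?_
  have hn' : ∀ i, n i = (0, 0) ∨ n i = (0, 1) := fun i => by
    simpa using Fintype.mem_piFinset.1 hn i
  by_cases hC : coeff β ((∏ i, monomial (g i) 1) * iterD n c) = 0
  · simp [hC]
  -- either all attached components lie below the weight `w`, or some jet vanishes on both sides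
  by_cases hg : ∀ i, pdeg (n i) < weight (g i)
  · obtain ⟨β', hβ', hw, hwi, hs⟩ := weight_of_coeff_ne_zero hn' hg hC a b
    have h2 := two_le_weight (hcT β' hβ')
    rw [hc β' hβ' (by omega), mul_one] at hs
    have hbb : (∏ i, b ^ (n i).2) * ∏ i, b ^ (n i).2 = 1 := Int.units_mul_self _
    have hs' : sign a b β = ∏ i, (sign a b (g i) * b ^ (n i).2) := by
      rw [Finset.prod_mul_distrib, ← hs, mul_assoc, hbb, mul_one]
    rw [Finset.prod_congr rfl fun i _ => jet_covariant (hn' i) b (sign a b (g i))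
        (hcov (g i) (by have := hwi i; omega)) z, Finset.prod_mul_distrib, hs', map_prod]
    ring
  · push Not at hg
    obtain ⟨i, hi⟩ := hg
    have h1 : ∏ i, jet Ψ (n i) (g i) z = 0 :=
      Finset.prod_eq_zero (Finset.mem_univ i) (jet_eq_zero hΨ (hn' i) hi z)
    have h2 : ∏ i, jet Φ (n i) (g i) (spaceFlip b z) = 0 :=
      Finset.prod_eq_zero (Finset.mem_univ i) (jet_eq_zero hΦ (hn' i) hi _)
    rw [h1, h2]
    simp

theorem vanishesOffT_renorm (K η : ℝ × ℝ → ℝ) (c : MvPolynomial Var ℝ) :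
    VanishesOffT (renorm K η c) := fun γ hT hn => by
  rw [renorm]; exact integrate_eq_zero hT hn _ _

theorem VanishesOffT.cutoff {Φ : MI → ℝ × ℝ → ℝ} (hΦ : VanishesOffT Φ) (p : MI → Prop)
    [DecidablePred p] : VanishesOffT fun γ => if _h : p γ then Φ γ else fun _ => 0 := fun γ hT hn => by
  simp only [hΦ γ hT hn]
  split_ifs <;> rfl

theorem renorm_covariant {K : ℝ × ℝ → ℝ} (hK : ∀ t x, K (t, -x) = K (t, x)) (η : ℝ × ℝ → ℝ)
    {a b : ℤˣ} {c : MvPolynomial Var ℝ} (hcT : ∀ β' ∈ c.support, β' ∈ T) {w : ℕ}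
    (hc : ∀ β' ∈ c.support, weight β' < w → sign a b β' = 1) {β : MI} (hβ : weight β < w)
    (z : ℝ × ℝ) :
    renorm K (act a b η) c β z = unitSign (sign a b β) * renorm K η c β (spaceFlip b z) := by
  induction β using WellFoundedLT.induction generalizing z with
  | ind β ih =>
    rw [renorm, renorm]
    refine integrate_covariant hK a b β (fun z => ?_) z
    have h := gammaStar_covariant (w := weight β)
      ((vanishesOffT_renorm K η c).cutoff (· < β))
      ((vanishesOffT_renorm K (act a b η) c).cutoff (· < β)) hcT
      (fun γ hγ z => ?_) (fun β' h h' => hc β' h (h'.trans hβ)) le_rfl z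
    · have hcβ : coeff β c = unitSign (sign a b β) * coeff β c := by
        by_cases h0 : β ∈ c.support
        · rw [hc β h0 hβ]; simp
        · rw [notMem_support_iff.1 h0]; simp
      rw [canonMinus_covariant hK]
      linear_combination h + hcβ
    · split_ifs with hlt
      · exact ih γ hlt (hγ.trans hβ) z
      · simp

theorem renormMinus_covariant {K : ℝ × ℝ → ℝ} (hK : ∀ t x, K (t, -x) = K (t, x)) (η : ℝ × ℝ → ℝ)
    {a b : ℤˣ} {c : MvPolynomial Var ℝ} (hcT : ∀ β' ∈ c.support, β' ∈ T) {β : MI}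
    (hc : ∀ β' ∈ c.support, weight β' < weight β → sign a b β' = 1) (z : ℝ × ℝ) :
    renormMinus K (act a b η) c β z - coeff β c =
      unitSign (sign a b β) * (renormMinus K η c β (spaceFlip b z) - coeff β c) := by
  have h := gammaStar_covariant (vanishesOffT_renorm K η c) (vanishesOffT_renorm K (act a b η) c)
    hcT (fun γ hγ => renorm_covariant hK η hcT hc hγ) hc le_rfl z
  rw [renormMinus, renormMinus, canonMinus_covariant hK]
  linear_combination h

/-- The monomials of `c` have weight at least `2`, so nothing can be attached when `β` has weight at
most `2`. -/
theorem gammaStar_of_weight_le_two {Φ : MI → ℝ × ℝ → ℝ} (hΦ : VanishesOffT Φ)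
    {c : MvPolynomial Var ℝ} (hcT : ∀ β' ∈ c.support, β' ∈ T) {β : MI} (hβ : weight β ≤ 2)
    (z : ℝ × ℝ) : gammaStar Φ c β z = coeff β c := by
  rw [gammaStar_eq, add_eq_left]
  refine Finset.sum_eq_zero fun l _ => mul_eq_zero_of_right _ <| Finset.sum_eq_zero fun n hn =>
    Finset.sum_eq_zero fun g _ => ?_
  have hn' : ∀ i, n i = (0, 0) ∨ n i = (0, 1) := fun i => by
    simpa using Fintype.mem_piFinset.1 hn i
  by_cases hg : ∀ i, pdeg (n i) < weight (g i)
  · by_contra hC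
    obtain ⟨β', hβ', hw, -⟩ := weight_of_coeff_ne_zero hn' hg (right_ne_zero_of_mul hC) 1 1
    have h2 := two_le_weight (hcT β' hβ')
    omega
  · push Not at hg
    obtain ⟨i, hi⟩ := hg
    rw [Finset.prod_eq_zero (Finset.mem_univ i) (jet_eq_zero hΦ (hn' i) hi z), zero_mul]

theorem canonMinus_noise_zero (K η : ℝ × ℝ → ℝ) (z : ℝ × ℝ) :
    canonMinus K η (Finsupp.single (.inl (.noise 0)) 1) z = η z := by
  have h0 : (Node.noise 0).mult (0, 0) = 0 := by simp [Node.mult]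
  have h1 : (Node.noise 0).mult (0, 1) = 0 := by simp [Node.mult]
  have : IsEmpty (Node.noise 0).Slot :=
    ((finCongr h0).sumCongr (finCongr h1)).isEmpty
  rw [canonMinus, canonRHS, Finsupp.support_single _ one_ne_zero, Finset.sum_singleton]
  simp [Node.source]

/-- The component of `z_(Ξ, e_(0,0)) z_(0,1)` is `x ξ_ε(t, x)`. -/
theorem canonMinus_noise_one_polyX (K η : ℝ × ℝ → ℝ) (z : ℝ × ℝ) :
    canonMinus K η (Finsupp.single (.inl (.noise 1)) 1 + Finsupp.single polyX 1) z =
      z.2 * η z := by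
  classical
  have h0 : (Node.noise 1).mult (0, 0) = 1 := by simp [Node.mult]
  have h1 : (Node.noise 1).mult (0, 1) = 0 := by simp [Node.mult]
  let _ : Unique (Node.noise 1).Slot :=
    (((finCongr h0).sumCongr (finCongr h1)).trans (Equiv.sumEmpty _ _)).unique
  have hslot : (Node.noise 1).slotDeriv default = (0, 0) := rfl
  have hsupp : (Finsupp.single (Sum.inl (Node.noise 1)) 1 + Finsupp.single polyX 1 : MI).support =
      {Sum.inl (Node.noise 1), polyX} := by
    rw [Finsupp.support_add_eq, Finsupp.support_single _ one_ne_zero,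
      Finsupp.support_single _ one_ne_zero]
    · rfl
    · rw [Finsupp.support_single _ one_ne_zero, Finsupp.support_single _ one_ne_zero]
      simp [polyX]
  have hcanon : canon K η (Finsupp.single polyX 1) z = z.2 := by
    rw [canon, polyX, integrate_single]
    simp
  rw [canonMinus, canonRHS, hsupp, Finset.sum_pair (by simp [polyX])]
  simp only [polyX, add_zero, add_tsub_cancel_left]
  rw [Finset.sum_eq_single fun _ => Finsupp.single polyX 1]
  · simp [hslot, tay_zero, hcanon, Node.source]
  · intro g hg hne
    refine absurd (funext fun i => ?_) hne
    have := (Finset.mem_piAntidiag.1 hg).1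
    rw [Fintype.sum_unique] at this
    rw [Unique.eq_default i, this]
    rfl
  · intro h
    refine absurd (Finset.mem_piAntidiag.2 ⟨?_, fun i _ => Finset.mem_univ i⟩) h
    rw [Fintype.sum_unique]
    rfl

/-! ### Measurability of the model on the space of smooth paths -/

/-- A random field with smooth paths, indexed by a measurable space `E`. Joint measurability in the
index and the point follows from these two conditions. -/
structure IsSmoothField {E : Type*} [MeasurableSpace E] (F : E → ℝ × ℝ → ℝ) : Prop where
  contDiff : ∀ e, ContDiff ℝ (⊤ : ℕ∞) (F e)
  measurable : ∀ z, Measurable fun e => F e z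

namespace IsSmoothField

variable {E : Type*} [MeasurableSpace E] {F G : E → ℝ × ℝ → ℝ}

theorem of_contDiff {f : ℝ × ℝ → ℝ} (hf : ContDiff ℝ (⊤ : ℕ∞) f) :
    IsSmoothField fun _ : E => f :=
  ⟨fun _ => hf, fun _ => measurable_const⟩

theorem add (hF : IsSmoothField F) (hG : IsSmoothField G) :
    IsSmoothField fun e z => F e z + G e z :=
  ⟨fun e => (hF.contDiff e).add (hG.contDiff e), fun z => (hF.measurable z).add (hG.measurable z)⟩

theorem mul (hF : IsSmoothField F) (hG : IsSmoothField G) :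
    IsSmoothField fun e z => F e z * G e z :=
  ⟨fun e => (hF.contDiff e).mul (hG.contDiff e), fun z => (hF.measurable z).mul (hG.measurable z)⟩

theorem sum {ι : Type*} {s : Finset ι} {F : ι → E → ℝ × ℝ → ℝ}
    (hF : ∀ i ∈ s, IsSmoothField (F i)) : IsSmoothField fun e z => ∑ i ∈ s, F i e z :=
  ⟨fun e => ContDiff.sum fun i hi => (hF i hi).contDiff e,
    fun z => Finset.measurable_fun_sum s fun i hi => (hF i hi).measurable z⟩

theorem prod {ι : Type*} {s : Finset ι} {F : ι → E → ℝ × ℝ → ℝ}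
    (hF : ∀ i ∈ s, IsSmoothField (F i)) : IsSmoothField fun e z => ∏ i ∈ s, F i e z :=
  ⟨fun e => contDiff_prod fun i hi => (hF i hi).contDiff e,
    fun z => Finset.measurable_fun_prod s fun i hi => (hF i hi).measurable z⟩

theorem tay {n : ℕ × ℕ} (hn : n = (0, 0) ∨ n = (0, 1)) (hF : IsSmoothField F) :
    IsSmoothField fun e => MultiIndexKPZ.tay n (F e) := by
  rcases hn with rfl | rfl
  · exact ⟨fun e => by simpa only [funext (tay_zero (F e))] using hF.contDiff e,
      fun z => by simpa only [tay_zero] using hF.measurable z⟩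
  · have hderiv : ∀ e z, HasDerivAt (fun y => F e (z.1, y)) (fderiv ℝ (F e) z (0, 1)) z.2 := by
      intro e z
      have h1 : HasFDerivAt (F e) (fderiv ℝ (F e) z) z :=
        ((hF.contDiff e).differentiable (by simp) z).hasFDerivAt
      have h2 : HasDerivAt (fun y : ℝ => (z.1, y)) ((0, 1) : ℝ × ℝ) z.2 :=
        (hasDerivAt_const z.2 z.1).prodMk (hasDerivAt_id z.2)
      exact h1.comp_hasDerivAt z.2 h2
    have htay : ∀ e z, MultiIndexKPZ.tay (0, 1) (F e) z = fderiv ℝ (F e) z (0, 1) :=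
      fun e z => by rw [tay_one, (hderiv e z).deriv]
    refine ⟨fun e => ?_, fun z => ?_⟩
    · rw [funext (htay e)]
      exact ((hF.contDiff e).fderiv_right (m := ((⊤ : ℕ∞) : WithTop ℕ∞)) (by simp)).clm_apply
        contDiff_const
    -- for a fixed point, the derivative is a limit of difference quotients
    · have hlim : ∀ e, Filter.Tendsto
          (fun k : ℕ => ((k : ℝ) + 1) * (F e (z.1, z.2 + 1 / ((k : ℝ) + 1)) - F e z))
          Filter.atTop (nhds (MultiIndexKPZ.tay (0, 1) (F e) z)) := by
        intro e
        rw [htay]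
        have h := (hderiv e z).tendsto_slope_zero_right
        have hk : Filter.Tendsto (fun k : ℕ => 1 / ((k : ℝ) + 1)) Filter.atTop
            (nhdsWithin 0 (Set.Ioi 0)) :=
          tendsto_nhdsWithin_iff.2 ⟨tendsto_one_div_add_atTop_nhds_zero_nat,
            .of_forall fun k => by simp only [Set.mem_Ioi]; positivity⟩
        refine (h.comp hk).congr fun k => ?_
        simp
      refine measurable_of_tendsto_metrizable (fun k => ?_) (tendsto_pi_nhds.2 hlim)
      exact ((hF.measurable _).sub (hF.measurable z)).const_mul _

theorem conv {K : ℝ × ℝ → ℝ} (hK : IsTruncatedHeatKernel K) (hF : IsSmoothField F) :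
    IsSmoothField fun e => MultiIndexKPZ.conv K (F e) := by
  refine ⟨fun e => contDiff_conv hK.integrable hK.compact (hF.contDiff e), fun z => ?_⟩
  have hjoint : Measurable (Function.uncurry fun w e => F e w) :=
    measurable_uncurry_of_continuous_of_measurable (fun e => (hF.contDiff e).continuous)
      hF.measurable
  have hint : Measurable (Function.uncurry fun (e : E) (w : ℝ × ℝ) => K w * F e (z - w)) :=
    (hK.measurable.comp measurable_snd).mul
      (hjoint.comp ((measurable_const.sub measurable_snd).prodMk measurable_fst))
  have := hint.stronglyMeasurable.integral_prod_right (ν := (volume : Measure (ℝ × ℝ)))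
  exact this.measurable

theorem integrate {K : ℝ × ℝ → ℝ} (hK : IsTruncatedHeatKernel K) (β : MI) (hF : IsSmoothField F) :
    IsSmoothField fun e => MultiIndexKPZ.integrate K β (F e) := by
  unfold MultiIndexKPZ.integrate
  split_ifs with h hT
  · exact of_contDiff (by fun_prop)
  · exact hF.conv hK
  · exact of_contDiff contDiff_const

theorem canonRHS {Φ : E → MI → ℝ × ℝ → ℝ} (hF : IsSmoothField F)
    (hΦ : ∀ γ, IsSmoothField fun e => Φ e γ) (β : MI) :
    IsSmoothField fun e => MultiIndexKPZ.canonRHS (F e) (Φ e) β := by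
  unfold MultiIndexKPZ.canonRHS
  refine sum fun w _ => ?_
  rcases w with v | n
  · refine sum fun g _ => mul (prod fun i _ => (hΦ (g i)).tay (slotDeriv_eq v i)) ?_
    cases v with
    | noise m => exact hF
    | drift k l => exact of_contDiff contDiff_const
  · exact of_contDiff contDiff_const

theorem canon {K : ℝ × ℝ → ℝ} (hK : IsTruncatedHeatKernel K) (hF : IsSmoothField F) (β : MI) :
    IsSmoothField fun e => MultiIndexKPZ.canon K (F e) β := by
  induction β using WellFoundedLT.induction with
  | ind β ih =>
    have h : IsSmoothField fun e => MultiIndexKPZ.canonRHS (F e)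
        (fun γ => if _h : γ < β then MultiIndexKPZ.canon K (F e) γ else fun _ => 0) β := by
      refine hF.canonRHS (fun γ => ?_) β
      split_ifs with hγ
      · exact ih γ hγ
      · exact of_contDiff contDiff_const
    have h' := h.integrate hK β
    refine (congrArg IsSmoothField (funext fun e => ?_)).mp h'
    exact (MultiIndexKPZ.canon.eq_1 K (F e) β).symm

theorem gammaStar {Φ : E → MI → ℝ × ℝ → ℝ} (hΦ : ∀ γ, IsSmoothField fun e => Φ e γ)
    (c : MvPolynomial Var ℝ) (β : MI) :
    IsSmoothField fun e => MultiIndexKPZ.gammaStar (Φ e) c β := by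
  unfold MultiIndexKPZ.gammaStar
  refine sum fun l _ => mul (of_contDiff contDiff_const) (sum fun n hn => sum fun g _ =>
    mul (prod fun i _ => ?_) (of_contDiff contDiff_const))
  unfold jet
  split_ifs
  · exact of_contDiff contDiff_const
  · exact (hΦ (g i)).tay (by simpa using Fintype.mem_piFinset.1 hn i)

theorem canonMinus {K : ℝ × ℝ → ℝ} (hK : IsTruncatedHeatKernel K) (hF : IsSmoothField F) (β : MI) :
    IsSmoothField fun e => MultiIndexKPZ.canonMinus K (F e) β :=
  hF.canonRHS (fun γ => hF.canon hK γ) β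

theorem renorm {K : ℝ × ℝ → ℝ} (hK : IsTruncatedHeatKernel K) (hF : IsSmoothField F)
    (c : MvPolynomial Var ℝ) (β : MI) :
    IsSmoothField fun e => MultiIndexKPZ.renorm K (F e) c β := by
  induction β using WellFoundedLT.induction with
  | ind β ih =>
    have h : IsSmoothField fun e => MultiIndexKPZ.gammaStar
        (fun γ => if _h : γ < β then MultiIndexKPZ.renorm K (F e) c γ else fun _ => 0) c β := by
      refine gammaStar (fun γ => ?_) c β
      split_ifs with hγ
      · exact ih γ hγ
      · exact of_contDiff contDiff_const
    have h' := ((hF.canonMinus hK β).add h).integrate hK β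
    refine (congrArg IsSmoothField (funext fun e => ?_)).mp h'
    exact (MultiIndexKPZ.renorm.eq_1 K (F e) c β).symm

theorem renormMinus {K : ℝ × ℝ → ℝ} (hK : IsTruncatedHeatKernel K) (hF : IsSmoothField F)
    (c : MvPolynomial Var ℝ) (β : MI) :
    IsSmoothField fun e => MultiIndexKPZ.renormMinus K (F e) c β :=
  (hF.canonMinus hK β).add (gammaStar (fun γ => hF.renorm hK c γ) c β)

end IsSmoothField

/-- Smooth functions on the plane, with the `σ`-algebra generated by the evaluations. This is the space
of paths of `ξ_ε`; on the space of all functions, convolutions and derivatives would not be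
measurable. -/
abbrev SmoothPath : Type := {f : ℝ × ℝ → ℝ // ContDiff ℝ (⊤ : ℕ∞) f}

theorem isSmoothField_eval : IsSmoothField fun f : SmoothPath => f.1 :=
  ⟨fun f => f.2, fun z => (measurable_pi_apply z).comp measurable_subtype_coe⟩

/-- Equality of laws can be tested in the ambient space, even when the subtype is not a measurable
subset. -/
theorem identDistrib_of_val {Ω α : Type*} [MeasurableSpace Ω] [MeasurableSpace α] {P : Measure Ω}
    {p : α → Prop} {X Y : Ω → Subtype p} (hX : Measurable X) (hY : Measurable Y)
    (h : IdentDistrib (fun ω => (X ω).1) (fun ω => (Y ω).1) P P) : IdentDistrib X Y P P := by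
  refine ⟨hX.aemeasurable, hY.aemeasurable, Measure.ext fun s hs => ?_⟩
  rw [Measure.map_apply hX hs, Measure.map_apply hY hs]
  obtain ⟨t, ht, rfl⟩ := hs
  exact h.measure_mem_eq ht

/-- If the law of the driving field is invariant under `(S η)(t, x) = a η(t, b x)`, then the constants
vanish on the multi-indices of sign `-1`. -/
theorem coeff_eq_zero_of_sign_eq_neg_one {Ω : Type*} [MeasurableSpace Ω] {P : Measure Ω}
    [IsProbabilityMeasure P] {K : ℝ × ℝ → ℝ} (hK : IsTruncatedHeatKernel K)
    {η : Ω → ℝ × ℝ → ℝ} (hη : IsSmoothField η) {a b : ℤˣ}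
    (hlaw : IdentDistrib (fun ω => act a b (η ω)) η P P) {δ : ℝ} {c : MvPolynomial Var ℝ}
    (hcT : ∀ β ∈ c.support, β ∈ Tneg δ)
    (hint : ∀ β ∈ Tneg δ, Integrable (fun ω => renormMinus K (η ω) c β 0) P)
    (hzero : ∀ β ∈ Tneg δ, ∫ ω, renormMinus K (η ω) c β 0 ∂P = 0)
    {β : MI} (hβ : β ∈ Tneg δ) (hs : sign a b β = -1) : coeff β c = 0 := by
  induction hw : weight β using Nat.strong_induction_on generalizing β with
  | _ w ih =>
  subst hw
  have hc : ∀ β' ∈ c.support, weight β' < weight β → sign a b β' = 1 := by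
    intro β' hβ' hlt
    refine (Int.units_eq_one_or _).resolve_right fun h => ?_
    exact mem_support_iff.1 hβ' (ih _ hlt (hcT β' hβ') h rfl)
  have hflip : ContDiff ℝ (⊤ : ℕ∞) (spaceFlip b) := by unfold spaceFlip; fun_prop
  let X : Ω → SmoothPath := fun ω => ⟨η ω, hη.contDiff ω⟩
  let Y : Ω → SmoothPath := fun ω =>
    ⟨act a b (η ω), contDiff_const.mul ((hη.contDiff ω).comp hflip)⟩
  have hX : Measurable X := (measurable_pi_iff.2 hη.measurable).subtype_mk
  have hY : Measurable Y :=
    (measurable_pi_iff.2 fun z => (hη.measurable (spaceFlip b z)).const_mul _).subtype_mk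
  -- the functional is odd under the symmetry, and its expectation is `-c_β`
  let H : SmoothPath → ℝ := fun f => renormMinus K f.1 c β 0 - coeff β c
  have hH : Measurable H := ((isSmoothField_eval.renormMinus hK c β).measurable 0).sub_const _
  have hYX : ∫ ω, H (Y ω) ∂P = ∫ ω, H (X ω) ∂P :=
    ((identDistrib_of_val hY hX hlaw).comp hH).integral_eq
  have hodd : ∀ ω, H (Y ω) = -H (X ω) := by
    intro ω
    have h := renormMinus_covariant hK.even (η ω) (fun β' h => (hcT β' h).1) hc 0
    rw [hs, unitSign_neg_one] at h
    have h0 : spaceFlip b 0 = 0 := by simp [spaceFlip]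
    rw [h0] at h
    change renormMinus K (act a b (η ω)) c β 0 - coeff β c =
      -(renormMinus K (η ω) c β 0 - coeff β c)
    linarith
  have hHX : ∫ ω, H (X ω) ∂P = -coeff β c := by
    change ∫ ω, (renormMinus K (η ω) c β 0 - coeff β c) ∂P = _
    rw [integral_sub (hint β hβ) (integrable_const _), hzero β hβ]
    simp
  simp only [hodd, integral_neg] at hYX
  linarith

/-! ### Multi-indices of negative homogeneity -/

/-- Contribution of a variable to `q(β)`: `0` for a noise variable, `2 - l` for
`z_(0, k e_(0,0) + l e_(0,1))` and `‖n‖` for `z_n`. -/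
def varExcess : Var → ℕ
  | .inl (.noise _) => 0
  | .inl (.drift _ l) => 2 - l
  | .inr n => pdeg n.1

/-- The number `q(β)` in `|β| = q(β) + (δ/2) ((β)) - 2 [β]`. -/
def excess : MI →+ ℕ := Finsupp.weight varExcess

theorem excess_eq_sum (β : MI) : excess β = ∑ v ∈ β.support, β v * varExcess v := by
  simp [excess, Finsupp.weight_apply, Finsupp.sum]

theorem hom_eq (δ : ℝ) (β : MI) :
    hom δ β = excess β + δ / 2 * noiseCount β - 2 * fert β := by
  rw [excess_eq_sum, hom, noiseCount, fert]
  simp only [Finsupp.sum]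
  push_cast
  rw [Finset.mul_sum, Finset.mul_sum, ← Finset.sum_add_distrib, ← Finset.sum_sub_distrib]
  refine Finset.sum_congr rfl fun v _ => ?_
  rcases v with (m | ⟨k, l⟩) | n
  · simp [varHom, varExcess, varNoise, varFert, Node.reg, Node.mult, Node.length]
    ring
  · have hl : (l : ℕ) ≤ 2 := by omega
    simp [varHom, varExcess, varNoise, varFert, Node.reg, Node.mult, Node.length, Nat.cast_sub hl]
    ring
  · simp [varHom, varExcess, varNoise, varFert]
    ring

theorem sign_one_neg_one (β : MI) : sign 1 (-1) β = (-1) ^ excess β := by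
  rw [excess_eq_sum, sign, Finsupp.prod, ← Finset.prod_pow_eq_pow_sum]
  refine Finset.prod_congr rfl fun v _ => ?_
  rw [mul_comm, pow_mul]
  congr 1
  rcases v with (m | ⟨k, l⟩) | n
  · simp [varSign, varExcess]
  · fin_cases l <;> simp [varSign, varExcess]
  · simp [varSign, varExcess, pdeg, pow_add]

theorem sign_neg_one_one (β : MI) : sign (-1) 1 β = (-1) ^ noiseCount β := by
  rw [noiseCount, Finsupp.sum, sign, Finsupp.prod, ← Finset.prod_pow_eq_pow_sum]
  refine Finset.prod_congr rfl fun v _ => ?_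
  rw [mul_comm, pow_mul]
  congr 1
  rcases v with (m | ⟨k, l⟩) | n <;> simp [varSign, varNoise]

theorem excess_le_one {δ : ℝ} (hδ : 0 < δ) {β : MI} (hβ : β ∈ Tneg δ) : excess β ≤ 1 := by
  obtain ⟨⟨hf, hn⟩, hh⟩ := hβ
  rw [hom_eq, hf] at hh
  have h1 : (0 : ℝ) < δ / 2 * noiseCount β := by positivity
  have : (excess β : ℝ) < 2 := by push_cast at hh; linarith
  have : excess β < 2 := by exact_mod_cast this
  omega

theorem eq_noise_or_drift_of_excess_eq_zero {β : MI} (h : excess β = 0) {v : Var}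
    (hv : v ∈ β.support) : (∃ k, v = Sum.inl (.noise k)) ∨ ∃ k, v = Sum.inl (.drift k 2) := by
  rw [excess_eq_sum, Finset.sum_eq_zero_iff] at h
  have h0 := (Nat.mul_eq_zero.1 (h v hv)).resolve_left (Finsupp.mem_support_iff.1 hv)
  rcases v with (m | ⟨k, l⟩) | ⟨n, hn⟩
  · exact .inl ⟨m, rfl⟩
  · refine .inr ⟨k, ?_⟩
    have : l = 2 := by
      simp only [varExcess] at h0
      omega
    rw [this]
  · exfalso
    simp only [varExcess, pdeg] at h0
    refine hn (Prod.ext ?_ ?_)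
    · change n.1 = 0; omega
    · change n.2 = 0; omega

/-- In the absence of excess, `((β)) - [β]` is a sum of nonnegative contributions of the variables,
which is zero only for `z_(Ξ,0)`. -/
theorem eq_single_noise_zero {β : MI} (hf : fert β = 1) (hn : noiseCount β = 1)
    (he : excess β = 0) : β = Finsupp.single (.inl (.noise 0)) 1 := by
  have hpos : ∀ v ∈ β.support, 0 ≤ (β v : ℤ) * (varNoise v - varFert v) := by
    intro v hv
    rcases eq_noise_or_drift_of_excess_eq_zero he hv with ⟨k, rfl⟩ | ⟨k, rfl⟩
    · simp only [varNoise, varFert, Node.length, Node.mult]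
      refine mul_nonneg (by positivity) ?_
      simp
    · simp only [varNoise, varFert, Node.length, Node.mult]
      refine mul_nonneg (by positivity) ?_
      simp
      omega
  have hsum : ∑ v ∈ β.support, (β v : ℤ) * (varNoise v - varFert v) = 0 := by
    have h1 : ((noiseCount β : ℕ) : ℤ) - fert β = 0 := by rw [hn, hf]; norm_num
    rw [← h1, noiseCount, fert, Finsupp.sum, Finsupp.sum]
    push_cast
    rw [← Finset.sum_sub_distrib]
    exact Finset.sum_congr rfl fun v _ => mul_sub _ _ _
  rw [Finset.sum_eq_zero_iff_of_nonneg hpos] at hsum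
  have hsupp : ∀ v ∈ β.support, v = Sum.inl (.noise 0) := by
    intro v hv
    have h0 := (mul_eq_zero.1 (hsum v hv)).resolve_left
      (by exact_mod_cast Finsupp.mem_support_iff.1 hv)
    rcases eq_noise_or_drift_of_excess_eq_zero he hv with ⟨k, rfl⟩ | ⟨k, rfl⟩
    · simp [varNoise, varFert, Node.length, Node.mult] at h0
      rw [h0]
    · simp [varNoise, varFert, Node.length, Node.mult] at h0
      omega
  have hβ : β = Finsupp.single (.inl (.noise 0)) (β (.inl (.noise 0))) := by
    refine Finsupp.eq_single_iff.2 ⟨fun v hv => by simpa using hsupp v hv, rfl⟩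
  rw [hβ, noiseCount, Finsupp.sum_single_index (by simp)] at hn
  simp only [varNoise, mul_one] at hn
  rw [hβ, hn]

theorem eq_single_or_sign_of_notMem_reducedNeg {δ : ℝ} (hδ : 0 < δ) {β : MI}
    (hβ : β ∈ Tneg δ \ reducedNeg δ) :
    β = Finsupp.single (.inl (.noise 0)) 1 ∨ sign 1 (-1) β = -1 := by
  obtain ⟨hT, hr⟩ := hβ
  have h1 := excess_le_one hδ hT
  rcases Nat.le_one_iff_eq_zero_or_eq_one.1 h1 with h0 | h0
  · refine .inl (eq_single_noise_zero hT.1.1 ?_ h0)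
    by_contra hne
    have := hT.1.2
    exact hr ⟨⟨fun v hv => eq_noise_or_drift_of_excess_eq_zero h0 hv, hT.1.1, by omega⟩, hT.2⟩
  · exact .inr (by rw [sign_one_neg_one, h0, pow_one])

/-! ### Symmetries of the law of the mollified noise -/

theorem single_noise_one_add_polyX_mem_Tneg {δ : ℝ} (hδ : δ < 1) :
    (Finsupp.single (.inl (.noise 1)) 1 + Finsupp.single polyX 1 : MI) ∈ Tneg δ := by
  have hf : fert (Finsupp.single (.inl (.noise 1)) 1 + Finsupp.single polyX 1) = 1 := by
    rw [fert, Finsupp.sum_add_index' (by simp) (by intros; push_cast; ring),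
      Finsupp.sum_single_index (by simp), Finsupp.sum_single_index (by simp)]
    simp [varFert, polyX, Node.length, Node.mult]
  have hn : noiseCount (Finsupp.single (.inl (.noise 1)) 1 + Finsupp.single polyX 1) = 1 := by
    rw [noiseCount, Finsupp.sum_add_index' (by simp) (by intros; ring),
      Finsupp.sum_single_index (by simp), Finsupp.sum_single_index (by simp)]
    simp [varNoise, polyX]
  have he : excess (Finsupp.single (.inl (.noise 1)) 1 + Finsupp.single polyX 1) = 1 := by
    rw [map_add, excess, Finsupp.weight_single, Finsupp.weight_single]
    simp [varExcess, polyX, pdeg]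
  refine ⟨⟨hf, by rw [hn]; exact one_pos⟩, ?_⟩
  rw [hom_eq, hf, hn, he]
  push_cast
  linarith

theorem isSmoothField_mollNoise {Ω : Type*} [MeasurableSpace Ω] {P : Measure Ω} {ρ : TestFn}
    {L : ℝ} {ξ : Ω → Distr} (hξ : IsAdmissible L ξ P) {ε : ℝ} (hε : 0 < ε) :
    IsSmoothField (mollNoise ρ ξ ε hε) :=
  ⟨contDiff_mollNoise ρ ξ ε hε, fun _ => hξ.measurable _⟩

/-- Reflection symmetry of `x η(t, x)` gives reflection symmetry of the law of `η`. The division by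
`x` is performed at points `x + 1 / (k + 1)` with `k → ∞`, in order to reach `x = 0` as well. -/
theorem identDistrib_reflect {Ω : Type*} [MeasurableSpace Ω] {P : Measure Ω}
    {η : Ω → ℝ × ℝ → ℝ} (hη : ∀ ω, Continuous (η ω))
    (h : IdentDistrib (fun ω (z : ℝ × ℝ) => -z.2 * η ω (z.1, -z.2))
      (fun ω (z : ℝ × ℝ) => -(z.2 * η ω z)) P P) :
    IdentDistrib (fun ω => act 1 (-1) (η ω)) η P P := by
  let x : ℝ → ℕ → ℝ := fun y k => y + 1 / ((k : ℝ) + 1)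
  have hx : ∀ y, Filter.Tendsto (x y) Filter.atTop (nhds y) := fun y => by
    simpa [x] using (tendsto_one_div_add_atTop_nhds_zero_nat (𝕜 := ℝ)).const_add y
  have hx0 : ∀ y, ∀ᶠ k in Filter.atTop, x y k ≠ 0 := by
    intro y
    by_cases hy : y = 0
    · refine .of_forall fun k => ?_
      simp only [x, hy, zero_add]
      positivity
    · exact (hx y).eventually_ne hy
  let q : (ℝ × ℝ → ℝ) → ℝ × ℝ → ℝ := fun f z =>
    Filter.limUnder Filter.atTop fun k => -(x z.2 k)⁻¹ * f (z.1, x z.2 k)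
  have hq : Measurable q := by
    refine measurable_pi_iff.2 fun z => ?_
    refine (StronglyMeasurable.limUnder fun k => ?_).measurable
    exact ((measurable_pi_apply _).const_mul _).stronglyMeasurable
  have e1 : (q ∘ fun ω (z : ℝ × ℝ) => -z.2 * η ω (z.1, -z.2)) = fun ω => act 1 (-1) (η ω) := by
    funext ω z
    have hlim : Filter.Tendsto (fun k => η ω (z.1, -x z.2 k)) Filter.atTop
        (nhds (η ω (z.1, -z.2))) :=
      ((hη ω).tendsto _).comp (tendsto_const_nhds.prodMk_nhds (hx z.2).neg)
    have : act 1 (-1) (η ω) z = η ω (z.1, -z.2) := by simp [act, spaceFlip, unitSign_neg_one]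
    rw [this]
    refine (hlim.congr' ?_).limUnder_eq
    filter_upwards [hx0 z.2] with k hk
    field_simp
  have e2 : (q ∘ fun ω (z : ℝ × ℝ) => -(z.2 * η ω z)) = η := by
    funext ω z
    have hlim : Filter.Tendsto (fun k => η ω (z.1, x z.2 k)) Filter.atTop (nhds (η ω z)) :=
      ((hη ω).tendsto _).comp (tendsto_const_nhds.prodMk_nhds (hx z.2))
    refine (hlim.congr' ?_).limUnder_eq
    filter_upwards [hx0 z.2] with k hk
    field_simp
  rw [← e1]
  conv => arg 2; rw [← e2]
  exact h.comp hq

/-- A centred Gaussian measure is symmetric, as its characteristic function is even. -/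
theorem map_neg_eq_of_isGaussian {E : Type*} [NormedAddCommGroup E] [NormedSpace ℝ E]
    [MeasurableSpace E] [BorelSpace E] [SecondCountableTopology E] [CompleteSpace E]
    {μ : Measure E} [IsGaussian μ] (h : ∀ l : StrongDual ℝ E, ∫ x, l x ∂μ = 0) :
    μ.map (fun x => -x) = μ := by
  have : IsFiniteMeasure (μ.map fun x : E => -x) := Measure.isFiniteMeasure_map _ _
  refine Measure.ext_of_charFunDual (funext fun l => ?_)
  have e : (fun x : E => -x) = (-ContinuousLinearMap.id ℝ E : E →L[ℝ] E) := by
    funext x; simp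
  rw [e, charFunDual_map, IsGaussian.charFunDual_eq, IsGaussian.charFunDual_eq]
  have e' : l ∘SL (-ContinuousLinearMap.id ℝ E) = -l := by ext x; simp
  have h' : ∀ l : StrongDual ℝ E, ∫ x, ((l x : ℝ) : ℂ) ∂μ = 0 := fun l => by
    rw [integral_complex_ofReal, h, Complex.ofReal_zero]
  rw [e', h', h']
  have hv : Var[⇑(-l); μ] = Var[⇑l; μ] := by
    rw [show ⇑(-l) = -⇑l from rfl, variance_neg]
  rw [hv]

theorem identDistrib_neg_of_isGaussianProcess {Ω S : Type*} [MeasurableSpace Ω] {P : Measure Ω}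
    [IsProbabilityMeasure P] {X : S → Ω → ℝ} (hX : IsGaussianProcess X P)
    (hm : ∀ s, Measurable (X s)) (h0 : ∀ s, ∫ ω, X s ω ∂P = 0) :
    IdentDistrib (fun ω s => -X s ω) (fun ω s => X s ω) P P := by
  have hm1 : Measurable fun ω s => X s ω := measurable_pi_iff.2 hm
  have hm2 : Measurable fun ω s => -X s ω := measurable_pi_iff.2 fun s => (hm s).neg
  refine (identDistrib_iff_forall_finset_identDistrib (X := fun s ω => -X s ω) hm2.aemeasurable
    hm1.aemeasurable).2 fun I => ?_
  have hmI : Measurable fun ω => I.restrict fun s => X s ω := measurable_pi_iff.2 fun s => hm s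
  have hmI' : Measurable fun ω => I.restrict fun s => -X s ω :=
    measurable_pi_iff.2 fun s => (hm s).neg
  refine ⟨hmI'.aemeasurable, hmI.aemeasurable, ?_⟩
  have hG := hX.hasGaussianLaw I
  have := hG.isGaussian_map
  have hint := hG.integrable
  have hmean : ∫ ω, (I.restrict fun s => X s ω) ∂P = 0 := by
    funext s
    have := (ContinuousLinearMap.proj (R := ℝ) (φ := fun _ : I => ℝ) s).integral_comp_comm hint
    exact this.symm.trans (h0 s)
  have h := map_neg_eq_of_isGaussian (μ := P.map fun ω => I.restrict fun s => X s ω) fun l => by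
    rw [integral_map hmI.aemeasurable l.continuous.aestronglyMeasurable,
      l.integral_comp_comm hint, hmean, map_zero]
  rw [Measure.map_map measurable_neg hmI] at h
  exact h

end MultiIndexKPZ

end

open MultiIndexKPZ
theorem proposition2p6 {Ω : Type*} [MeasurableSpace Ω] (P : Measure Ω) [IsProbabilityMeasure P]
    (δ : ℝ) (hδ₀ : 0 < δ) (hδ₁ : δ < 1)
    (K : ℝ × ℝ → ℝ) (hK : IsTruncatedHeatKernel K)
    (ρ : TestFn) (hρ : IsMollifier ρ)
    (L : ℝ) (hL : 0 ≤ L) (ξ : Ω → Distr) (hξ : IsSpatiallySymmetric δ K ρ L ξ P)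
    (ε : ℝ) (hε : 0 < ε) (c : MvPolynomial Var ℝ) (hc : IsBPHZ δ K ρ ξ P ε hε c) :
    (∀ β ∈ Tneg δ \ reducedNeg δ, MvPolynomial.coeff β c = 0) ∧
      (IsGaussianNoise ξ P → ∀ β ∈ Tneg δ \ reducedEvenNeg δ, MvPolynomial.coeff β c = 0) := by
  have hη : IsSmoothField (mollNoise ρ ξ ε hε) := isSmoothField_mollNoise hξ.admissible hε
  have hvanish : ∀ {a b : ℤˣ}, IdentDistrib (fun ω => act a b (mollNoise ρ ξ ε hε ω))
      (mollNoise ρ ξ ε hε) P P → ∀ β ∈ Tneg δ, sign a b β = -1 → coeff β c = 0 :=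
    fun hlaw β hβ hs => coeff_eq_zero_of_sign_eq_neg_one hK hη hlaw hc.support_subset
      (fun β hβ => hc.integrable β hβ 0) (fun β hβ => hc.expectation_eq_zero β hβ 0) hβ hs
  have hreflect : IdentDistrib (fun ω => act 1 (-1) (mollNoise ρ ξ ε hε ω))
      (mollNoise ρ ξ ε hε) P P := by
    have h := hξ.symmetric ε hε _ (single_noise_one_add_polyX_mem_Tneg hδ₁)
      (.inr (by simp [polyX]))
    simp only [canonMinus_noise_one_polyX] at h
    exact identDistrib_reflect (fun ω => (hη.contDiff ω).continuous) h
  have hone : ∀ β ∈ Tneg δ \ reducedNeg δ, coeff β c = 0 := by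
    intro β hβ
    rcases eq_single_or_sign_of_notMem_reducedNeg hδ₀ hβ with rfl | hs
    -- `β = z_(Ξ,0)`, where `Π^{-,c}_β = ξ_ε + c_β`
    · have hw : weight (Finsupp.single (.inl (.noise 0)) 1) ≤ 2 := by
        simp [varWeight]
      have h := hc.expectation_eq_zero _ hβ.1 0
      simp only [renormMinus, canonMinus_noise_zero, gammaStar_of_weight_le_two
        (vanishesOffT_renorm K _ c) (fun β' h => (hc.support_subset β' h).1) hw] at h
      have hint : Integrable (fun ω => mollNoise ρ ξ ε hε ω 0) P :=
        (hξ.admissible.moments _ 1).integrable (by norm_num)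
      rw [integral_add hint (integrable_const _)] at h
      have h0 : ∫ ω, mollNoise ρ ξ ε hε ω 0 ∂P = 0 := hξ.admissible.centered _
      simpa [h0] using h
    · exact hvanish hreflect β hβ.1 hs
  refine ⟨hone, fun hG β hβ => ?_⟩
  by_cases hr : β ∈ reducedNeg δ
  · have hodd : Odd (noiseCount β) := by
      rw [← Nat.not_even_iff_odd]
      exact fun he => hβ.2 ⟨⟨hr.1, he⟩, hr.2⟩
    have hneg := identDistrib_neg_of_isGaussianProcess (hG.comp_right (mollAt ρ ε hε))
      (fun z => hξ.admissible.measurable _) (fun z => hξ.admissible.centered _)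
    refine hvanish (a := -1) (b := 1) ?_ β hβ.1 (by rw [sign_neg_one_one, hodd.neg_one_pow])
    have e : (fun ω => act (-1) 1 (mollNoise ρ ξ ε hε ω)) =
        fun ω z => -mollNoise ρ ξ ε hε ω z := by
      funext ω z
      simp [act, spaceFlip, unitSign_neg_one]
    rw [e]
    exact hneg
  · exact hone β ⟨hβ.1, hr⟩
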